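/- Let $L=(L_t)_{t\in\mathbb R}$ be a two-sided $\mathbb R^d$-valued Lévy process on a probability space $(\Omega,\mathcal F,\mathbb P)$: $L_0=0$ almost surely, the increments are independent and stationary, and almost every sample path is càdlàg. Suppose that $L$ is square integrable and centered, i.e. $\mathbb E|L_t|^2<\infty$ and $\mathbb E L_t=0$ for all $t$, and that $L$ is not identically $0$ (some $L_t$ is not almost surely $0$). Let $f:\mathbb R\to\mathbb R$ be measurable and consider the moving average $$X_t=\int_{\mathbb R} f(t-s)\,dL_s,\qquad t\in\mathbb R .$$ Here a measurable function $h:\mathbb R\to\mathbb R$ is called $L$-integrable if there are simple functions $h_n$ (finite real linear combinations of indicators of bounded Borel sets) with $h_n\to h$ Lebesgue-a.e. such that $\int_{\mathbb R} h_n\mathbf 1_A\,dL$ converges in probability for every Borel set $A\subset\mathbb R$; then $\int_{\mathbb R} h\,dL_s$ is the limit in probability of $\int_{\mathbb R} h_n\,dL$. For simple functions, $\int\sum_i a_i\mathbf 1_{A_i}\,dL=\sum_i a_iL(A_i)$, where $A\mapsto L(A)$ is the independently scattered random measure on the bounded Borel sets with $L((s,t])=L_t-L_s$ for $s\le t$.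 1. $X$ is well defined as a square integrable process (for every $t$ the function $f(t-\cdot)$ is $L$-integrable and $\mathbb E|X_t|^2<\infty$) if and only if $f\in L^2(\mathbb R,ds)$. 2. If $f\in L^2(\mathbb R,ds)$, let $\widehat f\in L^2(\mathbb R;\mathbb C)$ be its Fourier transform in the sense of Plancherel. Then $\widehat f(\xi)\neq 0$ for Lebesgue-almost every $\xi\in\mathbb R$ if and only if the closed real linear spans agree: $$\overline{\operatorname{span}}\{X_t\}_{t\in\mathbb R}=\overline{\operatorname{span}}\{L_t\}_{t\in\mathbb R}\qquad\text{in } L^2(\Omega,\mathcal F,\mathbb P;\mathbb R^d).$$ -/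

import Mathlib

open MeasureTheory ProbabilityTheory Filter Topology
open scoped ENNReal FourierTransform

/-- The sample path `x` is right-continuous with left limits at every time. -/
def IsCadlagPath {E : Type*} [TopologicalSpace E] (x : ℝ → E) : Prop :=
  ∀ t : ℝ, ContinuousWithinAt x (Set.Ici t) t ∧ ∃ l : E, Tendsto x (𝓝[<] t) (𝓝 l)

/-- Two-sided Lévy process with values in `E`: a process started at `0`, with independent and
stationary increments and almost surely càdlàg sample paths. -/
structure IsLevyProcess {Ω E : Type*} [MeasurableSpace Ω] [NormedAddCommGroup E]
    [MeasurableSpace E] (P : Measure Ω) (L : ℝ → Ω → E) : Prop where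
  measurable : ∀ t, Measurable (L t)
  zero : L 0 =ᵐ[P] 0
  indep_increments : HasIndepIncrements L P
  stationary_increments : ∀ s t h : ℝ, s ≤ t →
    IdentDistrib (L (t + h) - L (s + h)) (L t - L s) P P
  cadlag : ∀ᵐ ω ∂P, IsCadlagPath fun t => L t ω

/-- The `δ`-ring of bounded Borel subsets of the line. -/
def IsBoundedBorel (A : Set ℝ) : Prop :=
  MeasurableSet A ∧ Bornology.IsBounded A

/-- `M` is the independently scattered random measure on the bounded Borel sets of the line which
is associated with the process `L`, that is, `M (s, t] = L t - L s` almost surely for `s ≤ t`.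
For a Lévy process `L` these properties determine every `M A` almost surely, and `M` is the
homogeneous Lévy basis of `L` (infinite divisibility of the `M A` is automatic). The series is
the limit of its partial sums; in general it does not converge absolutely. -/
structure IsAssociatedRandomMeasure {Ω E : Type*} [MeasurableSpace Ω] [NormedAddCommGroup E]
    [MeasurableSpace E] (P : Measure Ω) (L : ℝ → Ω → E) (M : Set ℝ → Ω → E) : Prop where
  measurable : ∀ A, IsBoundedBorel A → Measurable (M A)
  indep : ∀ A : ℕ → Set ℝ, (∀ n, IsBoundedBorel (A n)) → Pairwise (Function.onFun Disjoint A) →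
    iIndepFun (fun n => M (A n)) P
  sigma_additive : ∀ A : ℕ → Set ℝ, (∀ n, IsBoundedBorel (A n)) →
    Pairwise (Function.onFun Disjoint A) → IsBoundedBorel (⋃ n, A n) →
    ∀ᵐ ω ∂P, Tendsto (fun N => ∑ n ∈ Finset.range N, M (A n) ω) atTop (𝓝 (M (⋃ n, A n) ω))
  ioc : ∀ s t : ℝ, s ≤ t → M (Set.Ioc s t) =ᵐ[P] L t - L s

/-- The elementary integral `∑ aᵢ M(Aᵢ)` of a simple function `g = ∑ aᵢ 1_{Aᵢ}` of bounded
support, written with the distinct values `aᵢ` of `g` and their level sets `Aᵢ`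
(the value `0`, whose level set is unbounded, contributes `0`). -/
noncomputable def simpleStochIntegral {Ω E : Type*} [NormedAddCommGroup E] [NormedSpace ℝ E]
    (M : Set ℝ → Ω → E) (g : SimpleFunc ℝ ℝ) (ω : Ω) : E :=
  ∑ a ∈ g.range, a • M (g ⁻¹' {a}) ω

/-- `f` is `L`-integrable with stochastic integral `∫ f(s) dL_s = Y`. There are simple functions
`g n` of bounded support with `g n → f` almost everywhere, such that the elementary integrals of
`g n · 1_A` converge in probability for every Borel set `A`; and `Y` is the limit in probability
of the elementary integrals of `g n`. -/
def HasStochIntegral {Ω E : Type*} [MeasurableSpace Ω] [NormedAddCommGroup E] [NormedSpace ℝ E]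
    [MeasurableSpace E] (P : Measure Ω) (L : ℝ → Ω → E) (f : ℝ → ℝ) (Y : Ω → E) : Prop :=
  ∃ M : Set ℝ → Ω → E, IsAssociatedRandomMeasure P L M ∧
    ∃ g : ℕ → SimpleFunc ℝ ℝ,
      (∀ n, Bornology.IsBounded (Function.support (g n))) ∧
      (∀ᵐ s, Tendsto (fun n => g n s) atTop (𝓝 (f s))) ∧
      (∀ A : Set ℝ, MeasurableSet A → ∃ Z : Ω → E,
        TendstoInMeasure P (fun n => simpleStochIntegral M ((g n).restrict A)) atTop Z) ∧
      TendstoInMeasure P (fun n => simpleStochIntegral M (g n)) atTop Y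

/-- `X` is the continuous-time moving average `X t = ∫ f(t - s) dL_s` with kernel `f` driven by
`L`: for every `t` the function `s ↦ f(t - s)` is `L`-integrable, with integral `X t`. -/
def IsMovingAverage {Ω E : Type*} [MeasurableSpace Ω] [NormedAddCommGroup E] [NormedSpace ℝ E]
    [MeasurableSpace E] (P : Measure Ω) (L : ℝ → Ω → E) (f : ℝ → ℝ) (X : ℝ → Ω → E) : Prop :=
  ∀ t : ℝ, HasStochIntegral P L (fun s => f (t - s)) (X t)

/-- The closed real linear span of the random variables `X t` in `L²(Ω; E)`, for a process `X`
with square integrable values. -/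
noncomputable def closedSpanL2 {Ω E : Type*} [MeasurableSpace Ω] [NormedAddCommGroup E]
    [NormedSpace ℝ E] (P : Measure Ω) (X : ℝ → Ω → E) : Submodule ℝ (Lp E 2 P) :=
  (Submodule.span ℝ {Y : Lp E 2 P | ∃ t : ℝ, Y =ᵐ[P] X t}).topologicalClosure

/-- The Fourier transform of a square integrable function, in the sense of Plancherel. -/
noncomputable def plancherelFourier (f : ℝ → ℝ) (hf : MemLp f 2 volume) : Lp ℂ 2 (volume : Measure ℝ) :=
  𝓕 (MemLp.toLp (fun s => (f s : ℂ)) hf.ofReal)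

/-!
Let `σ² = E‖L 1‖²`. Stationarity and independence of the increments give
`E‖L t - L s‖² = σ² |t - s|`. By polarization the map `1_(s, t] ↦ L t - L s` preserves inner
products up to the factor `σ²`, so it extends to the Itô integral `W : L²(ℝ) → L²(Ω; E)` with
`‖W h‖ = σ ‖h‖` (`exists_isItoIntegral`). The theorem compares the stochastic integral, which is
defined by convergence in probability, with `W`.

The sets `A ↦ W 1_A` form the random measure of `L`: independence over disjoint sets follows by
approximating each set by those cells of a grid of which it fills more than half
(`IsItoIntegral.iIndepFun_indicator`), and almost sure `σ`-additivity is martingale convergence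
(`ae_tendsto_sum_of_iIndepFun`). By a Dynkin argument it is the only such measure
(`randomMeasure_unique`), so every elementary integral is a value of `W`.

Let `g n` be simple functions converging a.e. to `f` as in the definition of the integral. There is
`k : ℝ → ℕ` such that on each set `{k < K}` the `g n` are dominated by a constant and the integrals
converge in `L²` to `W (f 1_{k < K})`.

* If the integral `Y` is square integrable, `W (f 1_{k < K})` is independent of the integral over the
  complement, and it is centered. So `σ² ‖f 1_{k < K}‖² ≤ E‖Y‖²` for all `K`, and `f` is in `L²(ℝ)`
  (`IsItoIntegral.memLp_of_hasStochIntegral`).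
* If `f` is in `L²(ℝ)`, then `Y = W f` (`IsItoIntegral.ae_eq_of_hasStochIntegral`). What has to be
  excluded is that the integrals over `{K ≤ k}` retain mass in the limit. Since the integrals converge
  over every Borel set, this is a theorem of Vitali–Hahn–Saks type, proved by Baire category in the
  Cantor space of the subsets `{x | S (k x)}` (`eventually_truncatedMean_tail_le`).

Hence `X t = W (f (t - ·))`. As `W` is a closed embedding and the functions `1_(0, t]` and their
negative-time analogues span a dense subspace, the closed spans of `X` and `L` agree if and only if
the functions `f (t - ·)` span a dense subspace of `L²(ℝ)` (`IsItoIntegral.closedSpanL2_eq_iff`). By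
Plancherel the inner product of `f (t - ·)` and `h` is, as a function of `t`, the inverse Fourier
transform of the integrable function `conj (𝓕 f (-ξ)) 𝓕 h ξ`. It vanishes for all `t` if and only
if this function vanishes a.e., and this forces `h = 0` exactly when `𝓕 f` vanishes almost nowhere
(`topologicalClosure_span_translates_eq_top_iff`).
-/

namespace LevyMovingAverage

/-! ### Convergence in mean square and in probability -/

/-- Dominated convergence in `L²`. -/
theorem tendsto_eLpNorm_two_of_dominated {α ι : Type*} [MeasurableSpace α] {μ : Measure α}
    {l : Filter ι} [l.IsCountablyGenerated] [l.NeBot] {h : ι → α → ℝ} {h₀ G : α → ℝ}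
    (hm : ∀ i, Measurable (h i)) (hm₀ : Measurable h₀) (hG : MemLp G 2 μ)
    (hbound : ∀ i, ∀ᵐ s ∂μ, |h i s| ≤ G s)
    (hlim : ∀ᵐ s ∂μ, Tendsto (fun i => h i s) l (𝓝 (h₀ s))) :
    Tendsto (fun i => eLpNorm (h i - h₀) 2 μ) l (𝓝 0) := by
  obtain ⟨u, hu⟩ := l.exists_seq_tendsto
  -- the limit is dominated along a countable subfamily of indices
  have hbound₀ : ∀ᵐ s ∂μ, |h₀ s| ≤ G s := by
    have : ∀ᵐ s ∂μ, ∀ n, |h (u n) s| ≤ G s := ae_all_iff.2 fun n => hbound (u n)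
    filter_upwards [this, hlim] with s h1 h2
    exact le_of_tendsto ((h2.comp hu).abs) (Eventually.of_forall fun n => h1 n)
  have key : Tendsto (fun i => ∫⁻ s, ‖h i s - h₀ s‖ₑ ^ (2 : ℝ) ∂μ) l
      (𝓝 (∫⁻ _, 0 ∂μ)) := by
    refine tendsto_lintegral_filter_of_dominated_convergence
      (fun s => ‖(2 : ℝ) * G s‖ₑ ^ (2 : ℝ)) ?_ ?_ ?_ ?_
    · exact Eventually.of_forall fun i => ((hm i).sub hm₀).enorm.pow_const _
    · refine Eventually.of_forall fun i => ?_
      filter_upwards [hbound i, hbound₀] with s h1 h2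
      gcongr
      rw [enorm_le_iff_norm_le, Real.norm_eq_abs, Real.norm_eq_abs]
      have h3 := abs_sub (h i s) (h₀ s)
      have h4 : |2 * G s| = 2 * G s := abs_of_nonneg (by linarith [abs_nonneg (h₀ s)])
      linarith
    · have := (hG.const_mul 2).eLpNorm_lt_top
      have h2 := lintegral_rpow_enorm_lt_top_of_eLpNorm_lt_top (p := 2) (by simp) (by simp) this
      simpa using h2.ne
    · filter_upwards [hlim] with s hs
      have h1 : Tendsto (fun i => ‖h i s - h₀ s‖ₑ) l (𝓝 0) := by
        have := (hs.sub_const (h₀ s)).enorm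
        simpa using this
      have h2 := ((ENNReal.continuous_rpow_const (y := 2)).tendsto 0).comp h1
      rwa [ENNReal.zero_rpow_of_pos (by norm_num)] at h2
  have := ((ENNReal.continuous_rpow_const (y := (1 / 2 : ℝ))).tendsto _).comp key
  simp only [lintegral_zero] at this
  rw [ENNReal.zero_rpow_of_pos (by norm_num)] at this
  refine this.congr fun i => ?_
  rw [eLpNorm_eq_lintegral_rpow_enorm_toReal (by simp) (by simp)]
  simp

section Truncated

variable {Ω E : Type*} [MeasurableSpace Ω] {P : Measure Ω} [NormedAddCommGroup E]

/-- The truncated mean `E[min(‖Z‖, 1)]`; it metrizes convergence in probability. -/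
noncomputable def truncatedMean (P : Measure Ω) (Z : Ω → E) : ℝ≥0∞ :=
  ∫⁻ ω, min ‖Z ω‖ₑ 1 ∂P

theorem truncatedMean_congr {Z Z' : Ω → E} (h : Z =ᵐ[P] Z') :
    truncatedMean P Z = truncatedMean P Z' :=
  lintegral_congr_ae (by filter_upwards [h] with ω hω; rw [hω])

theorem truncatedMean_neg (Z : Ω → E) : truncatedMean P (-Z) = truncatedMean P Z := by
  simp [truncatedMean]

theorem truncatedMean_add_le {Z Z' : Ω → E} (hZ : AEStronglyMeasurable Z P) :
    truncatedMean P (Z + Z') ≤ truncatedMean P Z + truncatedMean P Z' := by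
  unfold truncatedMean
  rw [← lintegral_add_left' (hZ.enorm.min aemeasurable_const)]
  refine lintegral_mono fun ω => ?_
  simp only [Pi.add_apply]
  rcases le_total ‖Z ω‖ₑ 1 with h1 | h1
  · rcases le_total ‖Z' ω‖ₑ 1 with h2 | h2
    · rw [min_eq_left h1, min_eq_left h2]
      exact (min_le_left _ _).trans (enorm_add_le _ _)
    · rw [min_eq_right h2]
      exact (min_le_right _ _).trans le_add_self
  · rw [min_eq_right h1]
    exact (min_le_right _ _).trans le_self_add

theorem truncatedMean_le_eLpNorm [IsProbabilityMeasure P] {Z : Ω → E}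
    (hZ : AEStronglyMeasurable Z P) : truncatedMean P Z ≤ eLpNorm Z 2 P := by
  refine le_trans ?_ (eLpNorm_le_eLpNorm_of_exponent_le (p := 1) (by norm_num) hZ)
  rw [eLpNorm_one_eq_lintegral_enorm]
  exact lintegral_mono fun ω => min_le_left _ _

theorem truncatedMean_tendsto_zero [IsProbabilityMeasure P] {Z : ℕ → Ω → E} {Y : Ω → E}
    (hZ : TendstoInMeasure P Z atTop Y) (hm : ∀ n, AEStronglyMeasurable (Z n) P) :
    Tendsto (fun n => truncatedMean P (Z n - Y)) atTop (𝓝 0) := by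
  have hY : AEStronglyMeasurable Y P := hZ.aestronglyMeasurable hm
  rw [ENNReal.tendsto_atTop_zero]
  intro ε hε
  rcases eq_or_ne ε ∞ with rfl | hεt
  · exact ⟨0, fun n _ => le_top⟩
  have hε2 : 0 < ε / 2 := ENNReal.half_pos hε.ne'
  obtain ⟨N, hN⟩ := (ENNReal.tendsto_atTop_zero.1 (hZ (ε / 2) hε2)) (ε / 2) hε2
  refine ⟨N, fun n hn => ?_⟩
  have hpt : ∀ ω, min ‖(Z n - Y) ω‖ₑ 1 ≤
      ε / 2 + Set.indicator {ω | ε / 2 ≤ edist (Z n ω) (Y ω)} (fun _ => (1 : ℝ≥0∞)) ω := by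
    intro ω
    by_cases h : ε / 2 ≤ edist (Z n ω) (Y ω)
    · rw [Set.indicator_of_mem (by exact h)]
      exact (min_le_right _ _).trans le_add_self
    · rw [Set.indicator_of_notMem (by exact h), add_zero]
      refine (min_le_left _ _).trans ?_
      rw [Pi.sub_apply, ← edist_eq_enorm_sub]
      exact (not_le.1 h).le
  calc truncatedMean P (Z n - Y)
      ≤ ∫⁻ ω, ε / 2 + Set.indicator {ω | ε / 2 ≤ edist (Z n ω) (Y ω)} (fun _ => (1 : ℝ≥0∞)) ω ∂P :=
        lintegral_mono hpt
    _ = ε / 2 + ∫⁻ ω, Set.indicator {ω | ε / 2 ≤ edist (Z n ω) (Y ω)} (fun _ => (1 : ℝ≥0∞)) ω ∂P := by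
        rw [lintegral_add_left measurable_const]; simp
    _ ≤ ε / 2 + P {ω | ε / 2 ≤ edist (Z n ω) (Y ω)} := by
        gcongr
        exact lintegral_indicator_one_le _
    _ ≤ ε / 2 + ε / 2 := by gcongr; exact hN n hn
    _ = ε := ENNReal.add_halves ε

theorem ae_eq_zero_of_truncatedMean_eq_zero {Z : Ω → E} (hZ : AEStronglyMeasurable Z P)
    (h : truncatedMean P Z = 0) : Z =ᵐ[P] 0 := by
  rw [truncatedMean, lintegral_eq_zero_iff' (hZ.enorm.min aemeasurable_const)] at h
  filter_upwards [h] with ω hω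
  rcases min_choice ‖Z ω‖ₑ 1 with h1 | h1
  · simpa [h1] using hω
  · simp [h1] at hω

theorem truncatedMean_le_norm [IsProbabilityMeasure P] (Z : Lp E 2 P) :
    truncatedMean P (Z : Ω → E) ≤ ENNReal.ofReal ‖Z‖ := by
  refine (truncatedMean_le_eLpNorm (Lp.aestronglyMeasurable _)).trans ?_
  rw [Lp.norm_def, ENNReal.ofReal_toReal (Lp.eLpNorm_ne_top _)]

theorem truncatedMean_add_le_Lp (Z Z' : Lp E 2 P) :
    truncatedMean P ((Z + Z' : Lp E 2 P) : Ω → E) ≤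
      truncatedMean P (Z : Ω → E) + truncatedMean P (Z' : Ω → E) := by
  rw [truncatedMean_congr (Lp.coeFn_add Z Z')]
  exact truncatedMean_add_le (Lp.aestronglyMeasurable _)

theorem truncatedMean_sub_comm_Lp (Z Z' : Lp E 2 P) :
    truncatedMean P ((Z - Z' : Lp E 2 P) : Ω → E) =
      truncatedMean P ((Z' - Z : Lp E 2 P) : Ω → E) := by
  rw [← neg_sub Z' Z, truncatedMean_congr (Lp.coeFn_neg (Z' - Z)), truncatedMean_neg]

theorem isClosed_truncatedMean_le [IsProbabilityMeasure P] (ε : ℝ≥0∞) :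
    IsClosed {Z : Lp E 2 P | truncatedMean P (Z : Ω → E) ≤ ε} := by
  refine IsSeqClosed.isClosed fun Z Z₀ hZ hlim => ?_
  have h1 : Tendsto (fun n => ε + ENNReal.ofReal ‖Z₀ - Z n‖) atTop
      (𝓝 (ε + ENNReal.ofReal ‖Z₀ - Z₀‖)) :=
    (ENNReal.tendsto_ofReal (tendsto_const_nhds.sub hlim).norm).const_add ε
  rw [sub_self, norm_zero, ENNReal.ofReal_zero, add_zero] at h1
  refine ge_of_tendsto' h1 fun n => ?_
  have e : (Z₀ : Ω → E) =ᵐ[P] Z n + (Z₀ - Z n : Lp E 2 P) := by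
    filter_upwards [Lp.coeFn_sub Z₀ (Z n)] with ω hω
    rw [Pi.add_apply, hω, Pi.sub_apply, add_sub_cancel]
  calc truncatedMean P (Z₀ : Ω → E) = truncatedMean P (Z n + (Z₀ - Z n : Lp E 2 P) : Ω → E) :=
        truncatedMean_congr e
    _ ≤ truncatedMean P (Z n : Ω → E) + truncatedMean P ((Z₀ - Z n : Lp E 2 P) : Ω → E) :=
        truncatedMean_add_le (Lp.aestronglyMeasurable _)
    _ ≤ ε + ENNReal.ofReal ‖Z₀ - Z n‖ := by
        gcongr
        · exact hZ n
        · exact truncatedMean_le_norm _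

theorem tendstoInMeasure_add {Z Z' : ℕ → Ω → E} {Y Y' : Ω → E}
    (h : TendstoInMeasure P Z atTop Y) (h' : TendstoInMeasure P Z' atTop Y') :
    TendstoInMeasure P (fun n => Z n + Z' n) atTop (Y + Y') := by
  rw [tendstoInMeasure_iff_norm] at h h' ⊢
  intro ε hε
  have := (h (ε / 2) (by positivity)).add (h' (ε / 2) (by positivity))
  rw [add_zero] at this
  refine tendsto_of_tendsto_of_tendsto_of_le_of_le tendsto_const_nhds this
    (fun _ => zero_le) fun n => ?_
  refine (measure_mono ?_).trans (measure_union_le _ _)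
  intro ω hω
  by_contra hc
  simp only [Set.mem_union, Set.mem_ofPred_eq, not_or, not_le] at hc
  have h1 := norm_add_le (Z n ω - Y ω) (Z' n ω - Y' ω)
  have h2 : Z n ω - Y ω + (Z' n ω - Y' ω) = (Z n + Z' n) ω - (Y + Y') ω := by
    simp only [Pi.add_apply]; abel
  rw [h2] at h1
  have h3 : ε ≤ ‖(Z n + Z' n) ω - (Y + Y') ω‖ := hω
  linarith [hc.1, hc.2]

end Truncated

/-! ### Independence: limits and grouping -/

section Independence

variable {Ω E : Type*} [MeasurableSpace Ω] {P : Measure Ω}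
  [NormedAddCommGroup E]

theorem exists_subseq_tendsto_ae_finset {ι : Type*} {X : ℕ → ι → Ω → E} {Y : ι → Ω → E}
    (s : Finset ι) (h : ∀ i ∈ s, TendstoInMeasure P (fun n => X n i) atTop (Y i)) :
    ∃ ns : ℕ → ℕ, StrictMono ns ∧
      ∀ i ∈ s, ∀ᵐ ω ∂P, Tendsto (fun n => X (ns n) i ω) atTop (𝓝 (Y i ω)) := by
  classical
  induction s using Finset.induction_on with
  | empty => exact ⟨id, strictMono_id, by simp⟩
  | insert a s ha ih =>
    obtain ⟨ns, hns, hs⟩ := ih fun i hi => h i (Finset.mem_insert_of_mem hi)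
    obtain ⟨ms, hms, hm⟩ := ((h a (Finset.mem_insert_self a s)).comp
      hns.tendsto_atTop).exists_seq_tendsto_ae
    refine ⟨ns ∘ ms, hns.comp hms, fun i hi => ?_⟩
    rcases Finset.mem_insert.1 hi with rfl | hi
    · exact hm
    · filter_upwards [hs i hi] with ω hω using hω.comp hms.tendsto_atTop

theorem tendsto_charFun_map [IsProbabilityMeasure P] {H : Type*} [NormedAddCommGroup H]
    [InnerProductSpace ℝ H] [MeasurableSpace H] [BorelSpace H] [SecondCountableTopology H]
    {X : ℕ → Ω → H} {Y : Ω → H} (hX : ∀ n, AEMeasurable (X n) P) (hY : AEMeasurable Y P)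
    (h : ∀ᵐ ω ∂P, Tendsto (fun n => X n ω) atTop (𝓝 (Y ω))) (t : H) :
    Tendsto (fun n => charFun (P.map (X n)) t) atTop (𝓝 (charFun (P.map Y) t)) := by
  have hc : Continuous fun x : H => Complex.exp (↑(inner ℝ x t) * Complex.I) := by fun_prop
  have e : ∀ Z : Ω → H, AEMeasurable Z P → charFun (P.map Z) t =
      ∫ ω, Complex.exp (↑(inner ℝ (Z ω) t) * Complex.I) ∂P := fun Z hZ => by
    rw [charFun_apply, integral_map hZ hc.aestronglyMeasurable]
  simp_rw [fun n => e _ (hX n), e _ hY]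
  refine tendsto_integral_of_dominated_convergence (fun _ => 1) (fun n => ?_)
    (integrable_const _) (fun n => ?_) ?_
  · exact (hc.measurable.comp_aemeasurable (hX n)).aestronglyMeasurable
  · exact Eventually.of_forall fun ω => (Complex.norm_exp_ofReal_mul_I _).le
  · filter_upwards [h] with ω hω
    exact (hc.tendsto _).comp hω

variable [InnerProductSpace ℝ E] [FiniteDimensional ℝ E] [MeasurableSpace E] [BorelSpace E]

/-- Independence passes to limits in probability. -/
theorem iIndepFun_of_tendstoInMeasure [IsProbabilityMeasure P] {ι : Type*} [Fintype ι]
    {X : ℕ → ι → Ω → E} {Y : ι → Ω → E} (hX : ∀ n i, AEMeasurable (X n i) P)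
    (hind : ∀ n, iIndepFun (X n) P)
    (h : ∀ i, TendstoInMeasure P (fun n => X n i) atTop (Y i)) : iIndepFun Y P := by
  have : CompleteSpace E := FiniteDimensional.complete ℝ E
  have : ProperSpace E := FiniteDimensional.proper_real E
  have hY : ∀ i, AEMeasurable (Y i) P := fun i => (h i).aemeasurable fun n => hX n i
  obtain ⟨ns, -, hns⟩ := exists_subseq_tendsto_ae_finset Finset.univ fun i _ => h i
  rw [iIndepFun_iff_charFun_pi hY]
  intro t
  have h1 : Tendsto
      (fun n => charFun (P.map fun ω => WithLp.toLp 2 fun i => X (ns n) i ω) t) atTop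
      (𝓝 (charFun (P.map fun ω => WithLp.toLp 2 fun i => Y i ω) t)) := by
    refine tendsto_charFun_map (fun n => by fun_prop) (by fun_prop) ?_ t
    have : ∀ᵐ ω ∂P, ∀ i, Tendsto (fun n => X (ns n) i ω) atTop (𝓝 (Y i ω)) :=
      ae_all_iff.2 fun i => hns i (Finset.mem_univ i)
    filter_upwards [this] with ω hω
    exact ((PiLp.continuous_toLp 2 fun _ : ι => E).tendsto _).comp (tendsto_pi_nhds.2 hω)
  have h2 : Tendsto (fun n => ∏ i, charFun (P.map (X (ns n) i)) (t i)) atTop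
      (𝓝 (∏ i, charFun (P.map (Y i)) (t i))) :=
    tendsto_finsetProd _ fun i hi =>
      tendsto_charFun_map (fun n => hX _ i) (hY i) (hns i hi) (t i)
  refine tendsto_nhds_unique h1 (h2.congr fun n => ?_)
  exact ((iIndepFun_iff_charFun_pi (hX (ns n))).1 (hind (ns n)) t).symm

/-- Sums of an independent family over pairwise disjoint blocks of indices are independent. -/
theorem iIndepFun_sum_of_disjoint [IsProbabilityMeasure P] {κ ι : Type*} [Fintype ι]
    {ξ : κ → Ω → E} (hξ : ∀ j, AEMeasurable (ξ j) P) (hind : iIndepFun ξ P)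
    {J : ι → Finset κ} (hJ : Pairwise (Function.onFun Disjoint J)) :
    iIndepFun (fun i ω => ∑ j ∈ J i, ξ j ω) P := by
  classical
  have : CompleteSpace E := FiniteDimensional.complete ℝ E
  have : ProperSpace E := FiniteDimensional.proper_real E
  rw [iIndepFun_iff_charFun_pi fun i => by fun_prop]
  intro t
  -- `ζ j` carries `ξ j` in the coordinate of the block which contains `j`
  let A : κ → E → PiLp 2 (fun _ : ι => E) := fun j x =>
    WithLp.toLp 2 fun i => if j ∈ J i then x else 0
  have hA : ∀ j, Measurable (A j) := fun j => by
    refine (PiLp.continuous_toLp 2 fun _ : ι => E).measurable.comp (measurable_pi_lambda _ ?_)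
    intro i
    by_cases h : j ∈ J i
    · simpa [h] using measurable_id'
    · simp [h]
  let ζ : κ → Ω → PiLp 2 (fun _ : ι => E) := fun j ω => A j (ξ j ω)
  have hζ : ∀ j, AEMeasurable (ζ j) P := fun j => (hA j).comp_aemeasurable (hξ j)
  have hζind : iIndepFun ζ P := hind.comp A hA
  let U : Finset κ := Finset.univ.biUnion J
  have hsum : (fun ω => WithLp.toLp 2 fun i => ∑ j ∈ J i, ξ j ω) = ∑ j ∈ U, ζ j := by
    funext ω
    ext i
    rw [Finset.sum_apply]
    simp only [ζ, A, WithLp.ofLp_sum, Finset.sum_apply]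
    rw [← Finset.sum_filter]
    congr 1
    ext j
    simp only [U, Finset.mem_filter, Finset.mem_biUnion, Finset.mem_univ, true_and]
    exact ⟨fun h => ⟨⟨i, h⟩, h⟩, fun h => h.2⟩
  rw [hsum, iIndepFun.charFun_map_finsetSum_eq_prod (fun j _ => hζ j) (hζind.restrict _)]
  simp only [Finset.prod_apply, U]
  rw [Finset.prod_biUnion fun i _ j _ hij => hJ hij]
  refine Finset.prod_congr rfl fun i _ => ?_
  have h1 : (fun ω => ∑ j ∈ J i, ξ j ω) = ∑ j ∈ J i, ξ j := by
    funext ω; rw [Finset.sum_apply]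
  rw [h1, iIndepFun.charFun_map_finsetSum_eq_prod (fun j _ => hξ j) (hind.restrict _),
    Finset.prod_apply]
  refine Finset.prod_congr rfl fun j hj => ?_
  rw [charFun_apply, charFun_apply, integral_map (hζ j) (by fun_prop),
    integral_map (hξ j) (by fun_prop)]
  congr 1
  funext ω
  congr 3
  simp only [ζ, A, PiLp.inner_apply]
  rw [Finset.sum_eq_single i]
  · simp [hj]
  · intro k _ hk
    have : j ∉ J k := fun hjk => Finset.disjoint_left.1 (hJ hk) hjk hj
    simp [this]
  · simp

end Independence

/-! ### Second moments of the increments -/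

theorem integral_norm_increment_sq {Ω E : Type*} [MeasurableSpace Ω] {P : Measure Ω}
    [NormedAddCommGroup E] [MeasurableSpace E] [BorelSpace E] {L : ℝ → Ω → E}
    (hL : IsLevyProcess P L) {s t : ℝ} (hst : s ≤ t) :
    ∫ ω, ‖L t ω - L s ω‖ ^ 2 ∂P = ∫ ω, ‖L (t - s) ω - L 0 ω‖ ^ 2 ∂P := by
  have h := hL.stationary_increments 0 (t - s) s (by linarith)
  rw [sub_add_cancel, zero_add] at h
  exact (h.comp (u := fun x : E => ‖x‖ ^ 2) (by fun_prop)).integral_eq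

section SecondMoments

variable {Ω E : Type*} [MeasurableSpace Ω] {P : Measure Ω} [IsProbabilityMeasure P]
  [NormedAddCommGroup E] [InnerProductSpace ℝ E] [FiniteDimensional ℝ E] [MeasurableSpace E]
  [BorelSpace E]

/-- Independent square integrable variables, one of them centered, are orthogonal. -/
theorem integral_inner_eq_zero_of_indepFun {U V : Ω → E} (h : IndepFun U V P)
    (hU : MemLp U 2 P) (hV : MemLp V 2 P) (hU₀ : ∫ ω, U ω ∂P = 0) :
    ∫ ω, inner ℝ (U ω) (V ω) ∂P = 0 := by
  have : CompleteSpace E := FiniteDimensional.complete ℝ E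
  have h1 := h.integral_bilin (hU.integrable (by norm_num)) (hV.integrable (by norm_num))
    (innerSL ℝ)
  rw [hU₀, map_zero] at h1
  exact h1

theorem integral_norm_add_sq_of_indepFun {U V : Ω → E} (h : IndepFun U V P)
    (hU : MemLp U 2 P) (hV : MemLp V 2 P) (hU₀ : ∫ ω, U ω ∂P = 0) :
    ∫ ω, ‖U ω + V ω‖ ^ 2 ∂P = ∫ ω, ‖U ω‖ ^ 2 ∂P + ∫ ω, ‖V ω‖ ^ 2 ∂P := by
  have hin : Integrable (fun ω => inner ℝ (U ω) (V ω)) P := by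
    refine (hU.norm.integrable_mul hV.norm).mono (by
      exact hU.aestronglyMeasurable.inner hV.aestronglyMeasurable) ?_
    exact Eventually.of_forall fun ω => by simpa using! abs_real_inner_le_norm (U ω) (V ω)
  have hU2 := hU.integrable_norm_pow (p := 2) (by norm_num)
  have hV2 := hV.integrable_norm_pow (p := 2) (by norm_num)
  have h1 : Integrable (fun ω => 2 * inner ℝ (U ω) (V ω)) P := hin.const_mul 2
  have h2 : Integrable (fun ω => ‖U ω‖ ^ 2 + 2 * inner ℝ (U ω) (V ω)) P := hU2.add h1
  simp_rw [norm_add_sq_real]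
  rw [integral_add h2 hV2, integral_add hU2 h1, integral_const_mul,
    integral_inner_eq_zero_of_indepFun h hU hV hU₀]
  ring


variable {L : ℝ → Ω → E}

/-- The variance of the increments is additive in the length of the time interval, and monotone;
so it is proportional to the length. -/
theorem integral_norm_increment_sq_eq (hL : IsLevyProcess P L) (hL_sq : ∀ t, MemLp (L t) 2 P)
    (hL_centered : ∀ t, ∫ ω, L t ω ∂P = 0) {s t : ℝ} (hst : s ≤ t) :
    ∫ ω, ‖L t ω - L s ω‖ ^ 2 ∂P = (∫ ω, ‖L 1 ω - L 0 ω‖ ^ 2 ∂P) * (t - s) := by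
  rw [integral_norm_increment_sq hL hst]
  set φ : ℝ → ℝ := fun t => ∫ ω, ‖L t ω - L 0 ω‖ ^ 2 ∂P with hφ
  have hnn : ∀ t, 0 ≤ φ t := fun t => integral_nonneg fun ω => by positivity
  have hadd : ∀ a b, 0 ≤ a → 0 ≤ b → φ (a + b) = φ a + φ b := by
    intro a b ha hb
    have hind := hL.indep_increments.indepFun_sub_sub (r := 0) (s := a) (t := a + b) ha
      (by linarith)
    have hc : ∫ ω, (L a - L 0) ω ∂P = 0 := by
      have := integral_sub ((hL_sq a).integrable (by norm_num))
        ((hL_sq 0).integrable (by norm_num))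
      simpa [hL_centered] using this
    have := integral_norm_add_sq_of_indepFun hind ((hL_sq a).sub (hL_sq 0))
      ((hL_sq (a + b)).sub (hL_sq a)) hc
    have h2 := integral_norm_increment_sq hL (s := a) (t := a + b) (by linarith)
    simp only [Pi.sub_apply] at this
    rw [h2, add_sub_cancel_left] at this
    rw [← this]
    simp only [hφ]
    congr 1
    funext ω
    congr 2
    abel
  have h0 : φ 0 = 0 := by simp [hφ]
  have hnat : ∀ (n : ℕ) (a : ℝ), 0 ≤ a → φ (n * a) = n * φ a := by
    intro n a ha
    induction n with
    | zero => simp [h0]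
    | succ n ih =>
      push_cast
      rw [add_mul, one_mul, hadd _ _ (by positivity) ha, ih]
      ring
  have hmono : ∀ a b, 0 ≤ a → a ≤ b → φ a ≤ φ b := by
    intro a b ha hab
    have := hadd a (b - a) ha (by linarith)
    rw [add_sub_cancel] at this
    linarith [hnn (b - a)]
  have main : ∀ a, 0 ≤ a → φ a = φ 1 * a := by
    intro a ha
    -- compare `n a` with the integers next to it, and let `n → ∞`
    have hb : ∀ n : ℕ, n * |φ a - φ 1 * a| ≤ φ 1 := by
      intro n
      have e1 : φ (⌊n * a⌋₊ : ℝ) = ⌊n * a⌋₊ * φ 1 := by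
        simpa using hnat ⌊n * a⌋₊ 1 zero_le_one
      have e2 : φ ((⌊n * a⌋₊ : ℝ) + 1) = (⌊n * a⌋₊ + 1) * φ 1 := by
        rw [hadd _ _ (by positivity) zero_le_one, e1]; ring
      have hna : 0 ≤ n * a := by positivity
      have i1 := hmono _ _ (by positivity) (Nat.floor_le hna)
      have i2 := hmono _ _ hna (Nat.lt_floor_add_one (n * a)).le
      rw [e1, hnat n a ha] at i1
      rw [e2, hnat n a ha] at i2
      have j1 := mul_le_mul_of_nonneg_right (Nat.floor_le hna) (hnn 1)
      have j2 := mul_le_mul_of_nonneg_right (Nat.lt_floor_add_one (n * a)).le (hnn 1)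
      have : (n : ℝ) * |φ a - φ 1 * a| = |n * φ a - n * a * φ 1| := by
        rw [← abs_of_nonneg (Nat.cast_nonneg (α := ℝ) n), ← abs_mul,
          abs_of_nonneg (Nat.cast_nonneg (α := ℝ) n)]
        ring_nf
      rw [this, abs_le]
      constructor <;> linarith
    by_contra hne
    have hpos : 0 < |φ a - φ 1 * a| := abs_pos.2 (sub_ne_zero.2 hne)
    obtain ⟨n, hn⟩ := exists_nat_gt (φ 1 / |φ a - φ 1 * a|)
    rw [div_lt_iff₀ hpos] at hn
    linarith [hb n]
  exact main (t - s) (by linarith)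

end SecondMoments

/-! ### The Itô isometry -/

/-- The indicator function of the bounded interval `(a, b]` as an element of `L²(ℝ)`. -/
noncomputable def indicatorIoc (a b : ℝ) : Lp ℝ 2 (volume : Measure ℝ) :=
  indicatorConstLp 2 (measurableSet_Ioc (a := a) (b := b)) measure_Ioc_lt_top.ne (1 : ℝ)

/-- The function `1_(0, t]` for `t ≥ 0` and `-1_(t, 0]` for `t < 0`, whose stochastic integral
is `L t`. -/
noncomputable def signedIndicator (t : ℝ) : Lp ℝ 2 (volume : Measure ℝ) :=
  indicatorIoc 0 t - indicatorIoc t 0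

theorem signedIndicator_sub {s t : ℝ} (hst : s ≤ t) :
    signedIndicator t - signedIndicator s = indicatorIoc s t := by
  apply Lp.ext
  have hI : ∀ a b, indicatorIoc a b =ᵐ[volume] (Set.Ioc a b).indicator fun _ => (1 : ℝ) :=
    fun a b => indicatorConstLp_coeFn
  filter_upwards [Lp.coeFn_sub (signedIndicator t) (signedIndicator s),
    Lp.coeFn_sub (indicatorIoc 0 t) (indicatorIoc t 0),
    Lp.coeFn_sub (indicatorIoc 0 s) (indicatorIoc s 0), hI 0 t, hI t 0, hI 0 s, hI s 0, hI s t]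
    with x h1 h2 h3 h4 h5 h6 h7 h8
  rw [h1, Pi.sub_apply]
  unfold signedIndicator
  rw [h2, h3, Pi.sub_apply, Pi.sub_apply, h4, h5, h6, h7, h8]
  simp only [Set.indicator_apply, Set.mem_Ioc]
  split_ifs <;> grind

theorem norm_indicatorIoc_sq {s t : ℝ} (hst : s ≤ t) : ‖indicatorIoc s t‖ ^ 2 = t - s := by
  rw [indicatorIoc, norm_indicatorConstLp (by norm_num) (by norm_num)]
  simp only [norm_one, one_mul, Measure.real, Real.volume_Ioc, ENNReal.toReal_ofNat]
  rw [ENNReal.toReal_ofReal (by linarith), ← Real.sqrt_eq_rpow, Real.sq_sqrt (by linarith)]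

theorem signedIndicator_zero : signedIndicator 0 = 0 := by simp [signedIndicator]

theorem inner_signedIndicator (t : ℝ) (h : Lp ℝ 2 (volume : Measure ℝ)) :
    inner ℝ (signedIndicator t) h = ∫ x in (0 : ℝ)..t, h x := by
  rw [signedIndicator, inner_sub_left, indicatorIoc, indicatorIoc, L2.inner_indicatorConstLp_one,
    L2.inner_indicatorConstLp_one, intervalIntegral]

/-- The signed indicators span a dense subspace of `L²(ℝ)`: a function orthogonal to all of them
has vanishing primitive, so it vanishes by Lebesgue differentiation. -/
theorem topologicalClosure_span_signedIndicator :
    (Submodule.span ℝ (Set.range signedIndicator)).topologicalClosure = ⊤ := by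
  rw [Submodule.topologicalClosure_eq_top_iff, Submodule.eq_bot_iff]
  intro h hh
  have h0 : ∀ t, ∫ x in (0 : ℝ)..t, h x = 0 := fun t => by
    rw [← inner_signedIndicator]
    exact (Submodule.mem_orthogonal _ _).1 hh _ (Submodule.subset_span ⟨t, rfl⟩)
  rw [Lp.eq_zero_iff_ae_eq_zero]
  filter_upwards [LocallyIntegrable.ae_hasDerivAt_integral
    ((Lp.memLp h).locallyIntegrable (by norm_num))] with x hx
  have h1 := hx 0
  simp only [h0] at h1
  exact h1.unique (hasDerivAt_const x (0 : ℝ))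

section Isometry

variable {Ω E : Type*} [MeasurableSpace Ω] {P : Measure Ω}
  [NormedAddCommGroup E] [InnerProductSpace ℝ E]

/-- `W` is the Itô integral of `L` on `L²(ℝ)`: it is an isometry up to the factor `σ > 0`, and it
maps the signed indicator of `t` to `L t`; by linearity it maps `1_(s, t]` to `L t - L s`. -/
structure IsItoIntegral (P : Measure Ω) (L : ℝ → Ω → E) (σ : ℝ)
    (W : Lp ℝ 2 (volume : Measure ℝ) →L[ℝ] Lp E 2 P) : Prop where
  pos : 0 < σ
  norm_map : ∀ h, ‖W h‖ = σ * ‖h‖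
  map_signedIndicator : ∀ t, W (signedIndicator t) =ᵐ[P] L t

theorem norm_linearCombination_sq {H ι : Type*} [NormedAddCommGroup H] [InnerProductSpace ℝ H]
    (w : ι → H) (c : ι →₀ ℝ) : ‖Finsupp.linearCombination ℝ w c‖ ^ 2 =
      ∑ i ∈ c.support, ∑ j ∈ c.support, c i * c j * inner ℝ (w i) (w j) := by
  rw [← real_inner_self_eq_norm_sq, Finsupp.linearCombination_apply, Finsupp.sum, sum_inner]
  refine Finset.sum_congr rfl fun i _ => ?_
  rw [inner_sum]
  refine Finset.sum_congr rfl fun j _ => ?_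
  rw [real_inner_smul_left, real_inner_smul_right, mul_assoc]

variable [IsProbabilityMeasure P] [FiniteDimensional ℝ E] [MeasurableSpace E] [BorelSpace E]
  {L : ℝ → Ω → E}

/-- A square integrable centered Lévy process which is not identically zero has an Itô integral: the
processes `L` and `signedIndicator` have proportional Gram matrices, so that `∑ cᵢ 1ᵢ ↦ ∑ cᵢ L tᵢ`
is well defined and extends by density. -/
theorem exists_isItoIntegral (hL : IsLevyProcess P L) (hL_sq : ∀ t, MemLp (L t) 2 P)
    (hL_centered : ∀ t, ∫ ω, L t ω ∂P = 0) (hL_nonzero : ∃ t, ¬ L t =ᵐ[P] 0) :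
    ∃ σ W, IsItoIntegral P L σ W := by
  have : CompleteSpace E := FiniteDimensional.complete ℝ E
  let ℓ : ℝ → Lp E 2 P := fun t => (hL_sq t).toLp (L t)
  set v := ∫ ω, ‖L 1 ω - L 0 ω‖ ^ 2 ∂P with hv
  have hv0 : 0 ≤ v := integral_nonneg fun ω => by positivity
  have hnorm : ∀ s t, s ≤ t → ‖ℓ t - ℓ s‖ ^ 2 = v * (t - s) := by
    intro s t hst
    rw [← integral_norm_increment_sq_eq hL hL_sq hL_centered hst, ← real_inner_self_eq_norm_sq,
      L2.inner_def]
    refine integral_congr_ae ?_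
    filter_upwards [Lp.coeFn_sub (ℓ t) (ℓ s), (hL_sq t).coeFn_toLp, (hL_sq s).coeFn_toLp]
      with ω h1 h2 h3
    rw [real_inner_self_eq_norm_sq, h1, Pi.sub_apply, h2, h3]
  have hℓ0 : ℓ 0 = 0 := by
    rw [Lp.eq_zero_iff_ae_eq_zero]
    exact (hL_sq 0).coeFn_toLp.trans hL.zero
  have hdist : ∀ s t, ‖ℓ t - ℓ s‖ ^ 2 = v * ‖signedIndicator t - signedIndicator s‖ ^ 2 := by
    intro s t
    rcases le_total s t with h | h
    · rw [hnorm s t h, signedIndicator_sub h, norm_indicatorIoc_sq h]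
    · rw [norm_sub_rev, norm_sub_rev (signedIndicator t), hnorm t s h, signedIndicator_sub h,
        norm_indicatorIoc_sq h]
  have hsq : ∀ t, ‖ℓ t‖ ^ 2 = v * ‖signedIndicator t‖ ^ 2 := fun t => by
    simpa [hℓ0, signedIndicator_zero] using hdist 0 t
  -- polarization
  have hinner : ∀ s t, inner ℝ (ℓ s) (ℓ t) =
      v * inner ℝ (signedIndicator s) (signedIndicator t) := by
    intro s t
    rw [real_inner_eq_norm_mul_self_add_norm_mul_self_sub_norm_sub_mul_self_div_two,
      real_inner_eq_norm_mul_self_add_norm_mul_self_sub_norm_sub_mul_self_div_two]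
    simp only [← sq]
    rw [hsq, hsq, hdist]
    ring
  have hvpos : 0 < v := by
    refine lt_of_le_of_ne hv0 fun hv' => ?_
    obtain ⟨t, ht⟩ := hL_nonzero
    apply ht
    have h1 := hsq t
    rw [← hv', zero_mul, sq_eq_zero_iff, norm_eq_zero, Lp.eq_zero_iff_ae_eq_zero] at h1
    exact (hL_sq t).coeFn_toLp.symm.trans h1
  let e := Finsupp.linearCombination ℝ signedIndicator
  let f := Finsupp.linearCombination ℝ ℓ
  have hfe : ∀ c, ‖f c‖ = √v * ‖e c‖ := by
    intro c
    rw [← sq_eq_sq₀ (norm_nonneg _) (by positivity), mul_pow, Real.sq_sqrt hv0]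
    simp only [f, e]
    rw [norm_linearCombination_sq, norm_linearCombination_sq, Finset.mul_sum]
    refine Finset.sum_congr rfl fun i _ => ?_
    rw [Finset.mul_sum]
    refine Finset.sum_congr rfl fun j _ => ?_
    rw [hinner]; ring
  have hdense : DenseRange e := by
    have h1 := topologicalClosure_span_signedIndicator
    rw [← Finsupp.range_linearCombination] at h1
    intro x
    have h2 : x ∈ (LinearMap.range e).topologicalClosure := h1 ▸ Submodule.mem_top
    exact h2
  have hext := LinearMap.extendOfNorm_eq hdense ⟨√v, fun c => (hfe c).le⟩
  refine ⟨√v, f.extendOfNorm e, Real.sqrt_pos.2 hvpos, fun h => ?_, fun t => ?_⟩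
  · refine hdense.induction_on (p := fun h => ‖f.extendOfNorm e h‖ = √v * ‖h‖) h
      (isClosed_eq (by fun_prop) (by fun_prop)) fun c => ?_
    rw [hext, hfe]
  · have h1 := hext (Finsupp.single t 1)
    simp only [e, f, Finsupp.linearCombination_single, one_smul] at h1
    rw [h1]
    exact (hL_sq t).coeFn_toLp

end Isometry

/-! ### The Itô integral of a function -/

section ItoIntegral

variable {Ω E : Type*} [MeasurableSpace Ω] {P : Measure Ω}
  [NormedAddCommGroup E] [InnerProductSpace ℝ E]

open Classical in
/-- The Itô integral `W` applied to a function; it is `0` if the function is not square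
integrable. -/
noncomputable def itoIntegral (W : Lp ℝ 2 (volume : Measure ℝ) →L[ℝ] Lp E 2 P) (h : ℝ → ℝ) :
    Lp E 2 P :=
  if hh : MemLp h 2 volume then W (hh.toLp h) else 0

variable {W : Lp ℝ 2 (volume : Measure ℝ) →L[ℝ] Lp E 2 P}

theorem itoIntegral_of_memLp {h : ℝ → ℝ} (hh : MemLp h 2 volume) :
    itoIntegral W h = W (hh.toLp h) := dif_pos hh

theorem itoIntegral_add {h h' : ℝ → ℝ} (hh : MemLp h 2 volume) (hh' : MemLp h' 2 volume) :
    itoIntegral W (h + h') = itoIntegral W h + itoIntegral W h' := by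
  rw [itoIntegral_of_memLp hh, itoIntegral_of_memLp hh', itoIntegral_of_memLp (hh.add hh'),
    MemLp.toLp_add, map_add]

theorem itoIntegral_smul (a : ℝ) {h : ℝ → ℝ} (hh : MemLp h 2 volume) :
    itoIntegral W (a • h) = a • itoIntegral W h := by
  rw [itoIntegral_of_memLp hh, itoIntegral_of_memLp (hh.const_smul a), MemLp.toLp_const_smul,
    map_smul]

theorem itoIntegral_zero : itoIntegral W 0 = 0 := by
  rw [itoIntegral_of_memLp MemLp.zero, MemLp.toLp_zero, map_zero]

theorem itoIntegral_sum {κ : Type*} (s : Finset κ) {h : κ → ℝ → ℝ}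
    (hh : ∀ i ∈ s, MemLp (h i) 2 volume) :
    itoIntegral W (∑ i ∈ s, h i) = ∑ i ∈ s, itoIntegral W (h i) := by
  classical
  induction s using Finset.induction_on with
  | empty => simpa using itoIntegral_zero
  | insert a s ha ih =>
    rw [Finset.sum_insert ha, Finset.sum_insert ha, itoIntegral_add (hh a (by simp))
      (memLp_finsetSum' s fun i hi => hh i (by simp [hi])), ih fun i hi => hh i (by simp [hi])]

variable {L : ℝ → Ω → E} {σ : ℝ}

theorem IsItoIntegral.norm_itoIntegral (hW : IsItoIntegral P L σ W) {h : ℝ → ℝ}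
    (hh : MemLp h 2 volume) : ‖itoIntegral W h‖ = σ * (eLpNorm h 2 volume).toReal := by
  rw [itoIntegral_of_memLp hh, hW.norm_map, Lp.norm_toLp]

theorem tendsto_itoIntegral {ι : Type*} {l : Filter ι} {h : ι → ℝ → ℝ} {h₀ : ℝ → ℝ}
    (hh : ∀ i, MemLp (h i) 2 volume) (hh₀ : MemLp h₀ 2 volume)
    (hlim : Tendsto (fun i => eLpNorm (h i - h₀) 2 volume) l (𝓝 0)) :
    Tendsto (fun i => itoIntegral W (h i)) l (𝓝 (itoIntegral W h₀)) := by
  simp_rw [fun i => itoIntegral_of_memLp (W := W) (hh i), itoIntegral_of_memLp (W := W) hh₀]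
  refine (W.continuous.tendsto _).comp ?_
  exact (Lp.tendsto_Lp_iff_tendsto_eLpNorm'' _ hh _ hh₀).2 hlim

/-- The Itô integral is continuous under dominated convergence. -/
theorem tendsto_itoIntegral_of_dominated {ι : Type*} {l : Filter ι} [l.IsCountablyGenerated]
    [l.NeBot] {h : ι → ℝ → ℝ} {h₀ G : ℝ → ℝ} (hm : ∀ i, Measurable (h i)) (hm₀ : Measurable h₀)
    (hG : MemLp G 2 volume) (hbound : ∀ i, ∀ᵐ s, |h i s| ≤ G s)
    (hlim : ∀ᵐ s, Tendsto (fun i => h i s) l (𝓝 (h₀ s))) (hh₀ : MemLp h₀ 2 volume) :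
    Tendsto (fun i => itoIntegral W (h i)) l (𝓝 (itoIntegral W h₀)) :=
  tendsto_itoIntegral (fun i => hG.mono' (hm i).aestronglyMeasurable (hbound i)) hh₀
    (tendsto_eLpNorm_two_of_dominated hm hm₀ hG hbound hlim)

theorem memLp_indicator_one {A : Set ℝ} (hA : IsBoundedBorel A) :
    MemLp (A.indicator fun _ => (1 : ℝ)) 2 volume :=
  memLp_indicator_const 2 hA.1 1 (Or.inr hA.2.measure_lt_top.ne)

theorem isBoundedBorel_Ioc (s t : ℝ) : IsBoundedBorel (Set.Ioc s t) :=
  ⟨measurableSet_Ioc, Metric.isBounded_Ioc s t⟩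

theorem IsItoIntegral.itoIntegral_Ioc (hW : IsItoIntegral P L σ W) {s t : ℝ} (hst : s ≤ t) :
    itoIntegral W ((Set.Ioc s t).indicator fun _ => (1 : ℝ)) =ᵐ[P] L t - L s := by
  have h1 : itoIntegral W ((Set.Ioc s t).indicator fun _ => (1 : ℝ)) =
      W (signedIndicator t) - W (signedIndicator s) := by
    rw [itoIntegral_of_memLp (memLp_indicator_one (isBoundedBorel_Ioc s t)), ← map_sub,
      signedIndicator_sub hst]
    rfl
  rw [h1]
  filter_upwards [Lp.coeFn_sub (W (signedIndicator t)) (W (signedIndicator s)),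
    hW.map_signedIndicator t, hW.map_signedIndicator s] with ω h2 h3 h4
  rw [h2, Pi.sub_apply, Pi.sub_apply, h3, h4]

/-- Stochastic integrals with respect to a centered process are centered. -/
theorem IsItoIntegral.integral_itoIntegral [IsProbabilityMeasure P] [FiniteDimensional ℝ E]
    (hW : IsItoIntegral P L σ W)
    (hL_centered : ∀ t, ∫ ω, L t ω ∂P = 0) (h : ℝ → ℝ) : ∫ ω, itoIntegral W h ω ∂P = 0 := by
  have : CompleteSpace E := FiniteDimensional.complete ℝ E
  have hinner : ∀ (c : E) (Z : Lp E 2 P),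
      inner ℝ ((memLp_const (p := 2) (μ := P) c).toLp _) Z = inner ℝ c (∫ ω, Z ω ∂P) := by
    intro c Z
    rw [L2.inner_def, ← integral_inner ((Lp.memLp Z).integrable (by norm_num))]
    refine integral_congr_ae ?_
    filter_upwards [(memLp_const (p := 2) (μ := P) c).coeFn_toLp] with ω hω
    rw [hω]
  have hspan : ∀ (c : E) (x : Lp ℝ 2 (volume : Measure ℝ)),
      inner ℝ ((memLp_const (p := 2) (μ := P) c).toLp _) (W x) = 0 := by
    intro c x
    have hx : x ∈ (Submodule.span ℝ (Set.range signedIndicator)).topologicalClosure := by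
      rw [topologicalClosure_span_signedIndicator]; exact Submodule.mem_top
    have hcl : IsClosed {x : Lp ℝ 2 (volume : Measure ℝ) |
        inner ℝ ((memLp_const (p := 2) (μ := P) c).toLp _) (W x) = 0} :=
      isClosed_eq (by fun_prop) continuous_const
    refine closure_minimal (fun y hy => ?_) hcl hx
    induction hy using Submodule.span_induction with
    | mem y hy =>
      obtain ⟨t, rfl⟩ := hy
      show inner ℝ _ _ = 0
      rw [hinner, integral_congr_ae (hW.map_signedIndicator t), hL_centered, inner_zero_right]
    | zero => show inner ℝ _ _ = 0; rw [map_zero, inner_zero_right]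
    | add y z _ _ hy hz =>
      show inner ℝ _ _ = 0
      rw [map_add, inner_add_right, show inner ℝ _ _ = 0 from hy, show inner ℝ _ _ = 0 from hz,
        add_zero]
    | smul a y _ hy =>
      show inner ℝ _ _ = 0
      rw [map_smul, inner_smul_right, show inner ℝ _ _ = 0 from hy, mul_zero]
  by_cases hh : MemLp h 2 volume
  · have h1 := hspan (∫ ω, itoIntegral W h ω ∂P) (hh.toLp h)
    rw [hinner, ← itoIntegral_of_memLp hh] at h1
    exact inner_self_eq_zero.1 h1
  · rw [itoIntegral, dif_neg hh, integral_congr_ae (Lp.coeFn_zero E 2 P)]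
    simp

/-- The level set of the value `0` may be unbounded; its indicator then has the junk integral `0`,
which is multiplied by `0` anyway. -/
theorem itoIntegral_simpleFunc {g : SimpleFunc ℝ ℝ}
    (hg : Bornology.IsBounded (Function.support g)) : itoIntegral W g =
      ∑ a ∈ g.range, a • itoIntegral W ((g ⁻¹' {a}).indicator fun _ => (1 : ℝ)) := by
  have hb : ∀ a ≠ 0, IsBoundedBorel (g ⁻¹' {a}) := fun a ha =>
    ⟨g.measurableSet_fiber a, hg.subset fun x hx => by
      rw [Function.mem_support, show g x = a from hx]; exact ha⟩
  have hterm : ∀ a, a • itoIntegral W ((g ⁻¹' {a}).indicator fun _ => (1 : ℝ)) =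
      itoIntegral W (a • (g ⁻¹' {a}).indicator fun _ => (1 : ℝ)) := by
    intro a
    rcases eq_or_ne a 0 with rfl | ha
    · rw [zero_smul, zero_smul, itoIntegral_zero]
    · rw [itoIntegral_smul a (memLp_indicator_one (hb a ha))]
  simp_rw [hterm]
  rw [← itoIntegral_sum]
  · congr 1
    funext x
    rw [Finset.sum_apply, Finset.sum_eq_single (g x)]
    · simp
    · intro a _ ha
      have : x ∉ g ⁻¹' {a} := fun h => ha (Eq.symm h)
      simp [this]
    · exact fun h => absurd (g.mem_range_self x) h
  · intro a _
    rcases eq_or_ne a 0 with rfl | ha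
    · rw [zero_smul]; exact MemLp.zero
    · exact (memLp_indicator_one (hb a ha)).const_smul a

theorem memLp_simpleFunc {g : SimpleFunc ℝ ℝ} (hg : Bornology.IsBounded (Function.support g)) :
    MemLp g 2 volume := by
  obtain ⟨C, hC⟩ := g.exists_forall_norm_le
  have h1 : MemLp ((Function.support g).indicator fun _ => C) 2 volume :=
    memLp_indicator_const 2 g.measurableSet_support C (Or.inr hg.measure_lt_top.ne)
  refine h1.mono' g.measurable.aestronglyMeasurable (Eventually.of_forall fun x => ?_)
  by_cases hx : g x = 0
  · simp [hx]
  · rw [Set.indicator_of_mem (by exact hx)]; exact hC x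

end ItoIntegral

/-! ### Independence of the integrals over disjoint sets -/

/-- At a Lebesgue point of `A`, more than half of every small interval belongs to `A`. -/
theorem ae_eventually_Ioc_lt_two_mul (A : Set ℝ) : ∀ᵐ x ∂(volume.restrict A), ∀ a b : ℕ → ℝ,
    (∀ n, a n < x ∧ x ≤ b n) → Tendsto (fun n => b n - a n) atTop (𝓝 0) →
    ∀ᶠ n in atTop, volume.real (Set.Ioc (a n) (b n)) <
      2 * volume.real (A ∩ Set.Ioc (a n) (b n)) := by
  filter_upwards [IsUnifLocDoublingMeasure.ae_tendsto_measure_inter_div volume A 1]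
    with x hx a b hab hlim
  have h1 := hx (fun n => (a n + b n) / 2) (fun n => (b n - a n) / 2) (l := atTop) ?_ ?_
  · have h2 := h1.eventually (lt_mem_nhds (show (1 / 2 : ℝ≥0∞) < 1 by simp))
    filter_upwards [h2] with n hn
    have hball : Metric.closedBall ((a n + b n) / 2) ((b n - a n) / 2) =ᵐ[volume]
        Set.Ioc (a n) (b n) := by
      rw [Real.closedBall_eq_Icc]
      ring_nf
      exact Ioc_ae_eq_Icc.symm
    rw [measure_congr hball, measure_congr ((ae_eq_refl A).inter hball)] at hn
    have hfin : volume (A ∩ Set.Ioc (a n) (b n)) ≠ ∞ :=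
      measure_ne_top_of_subset Set.inter_subset_right measure_Ioc_lt_top.ne
    have hpos : volume (Set.Ioc (a n) (b n)) ≠ 0 := by
      rw [Real.volume_Ioc]; simpa using (hab n).1.trans_le (hab n).2
    have h3 := ENNReal.toReal_strict_mono (ENNReal.div_lt_top hfin hpos).ne hn
    rw [ENNReal.toReal_div, ENNReal.toReal_div] at h3
    change _ < volume.real _ / volume.real _ at h3
    have hpos' : 0 < volume.real (Set.Ioc (a n) (b n)) :=
      ENNReal.toReal_pos hpos measure_Ioc_lt_top.ne
    rw [lt_div_iff₀ hpos'] at h3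
    simp only [ENNReal.toReal_one, ENNReal.toReal_ofNat] at h3
    linarith
  · rw [tendsto_nhdsWithin_iff]
    refine ⟨by simpa using hlim.div_const 2, Eventually.of_forall fun n => ?_⟩
    have := (hab n).1.trans_le (hab n).2
    simp only [Set.mem_Ioi]; linarith
  · refine Eventually.of_forall fun n => ?_
    rw [Metric.mem_closedBall, Real.dist_eq, abs_le]
    constructor <;> linarith [(hab n).1, (hab n).2]

section Grid

/-- The points of the grid of mesh `1 / (n + 1)` which starts at `-N`. -/
noncomputable def gridPoint (N n j : ℕ) : ℝ := -N + j / (n + 1)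

/-- The cells of the grid. -/
noncomputable def gridCell (N n j : ℕ) : Set ℝ := Set.Ioc (gridPoint N n j) (gridPoint N n (j + 1))

theorem monotone_gridPoint (N n : ℕ) : Monotone (gridPoint N n) := by
  intro i j hij
  unfold gridPoint
  gcongr

theorem isBoundedBorel_gridCell (N n j : ℕ) : IsBoundedBorel (gridCell N n j) :=
  isBoundedBorel_Ioc _ _

theorem gridPoint_succ_sub (N n j : ℕ) :
    gridPoint N n (j + 1) - gridPoint N n j = 1 / (n + 1) := by
  unfold gridPoint
  push_cast
  field_simp
  ring

theorem pairwise_disjoint_gridCell (N n : ℕ) : Pairwise (Function.onFun Disjoint (gridCell N n)) :=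
  (monotone_gridPoint N n).pairwise_disjoint_on_Ioc_succ

theorem exists_mem_gridCell (N n : ℕ) {x : ℝ} (hx : x ∈ Set.Ioc (-N : ℝ) N) :
    ∃ j < 2 * N * (n + 1), x ∈ gridCell N n j := by
  have hn : (0 : ℝ) < n + 1 := by positivity
  have hpos : 0 < (x + N) * (n + 1) := mul_pos (by linarith [hx.1]) hn
  obtain ⟨j, hj⟩ : ∃ j, ⌈(x + N) * (n + 1)⌉₊ = j + 1 :=
    Nat.exists_eq_succ_of_ne_zero (Nat.ceil_pos.2 hpos).ne'
  have h1 := Nat.le_ceil ((x + N) * (n + 1))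
  have h2 := Nat.ceil_lt_add_one hpos.le
  rw [hj] at h1 h2
  push_cast at h1 h2
  refine ⟨j, ?_, ?_, ?_⟩
  · have h3 : (x + N) * (n + 1) ≤ 2 * N * (n + 1) :=
      mul_le_mul_of_nonneg_right (by linarith [hx.2]) hn.le
    have : (j : ℝ) < ((2 * N * (n + 1) : ℕ) : ℝ) := by push_cast; linarith
    exact_mod_cast this
  · unfold gridPoint
    have : (j : ℝ) / (n + 1) < x + N := by rw [div_lt_iff₀ hn]; linarith
    linarith
  · unfold gridPoint
    have : x + N ≤ ((j + 1 : ℕ) : ℝ) / (n + 1) := by rw [le_div_iff₀ hn]; push_cast; linarith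
    linarith

open Classical in
/-- The cells in `(-N, N]` more than half of which belongs to `A`. -/
noncomputable def majorityCells (N n : ℕ) (A : Set ℝ) : Finset ℕ :=
  {j ∈ Finset.range (2 * N * (n + 1)) |
    volume.real (gridCell N n j) < 2 * volume.real (A ∩ gridCell N n j)}

theorem disjoint_majorityCells (N n : ℕ) {A B : Set ℝ} (hB : MeasurableSet B)
    (hAB : Disjoint A B) : Disjoint (majorityCells N n A) (majorityCells N n B) := by
  rw [Finset.disjoint_left]
  intro j hA hB'
  simp only [majorityCells, Finset.mem_filter] at hA hB'
  have h1 : volume.real (A ∩ gridCell N n j) + volume.real (B ∩ gridCell N n j) ≤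
      volume.real (gridCell N n j) := by
    have hf : volume (gridCell N n j) ≠ ∞ := measure_Ioc_lt_top.ne
    rw [← measureReal_union (hAB.mono Set.inter_subset_left Set.inter_subset_left)
      (hB.inter (isBoundedBorel_gridCell N n j).1)
      (measure_ne_top_of_subset Set.inter_subset_right hf)
      (measure_ne_top_of_subset Set.inter_subset_right hf)]
    exact measureReal_mono (Set.union_subset Set.inter_subset_right Set.inter_subset_right) hf
  linarith [hA.2, hB'.2]

/-- The approximation of `1_A` by indicators of cells. -/
noncomputable def gridApprox (N n : ℕ) (A : Set ℝ) : ℝ → ℝ :=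
  ∑ j ∈ majorityCells N n A, (gridCell N n j).indicator fun _ => (1 : ℝ)

theorem gridApprox_apply_of_mem {N n j : ℕ} {A : Set ℝ} {x : ℝ} (hx : x ∈ gridCell N n j) :
    gridApprox N n A x = if j ∈ majorityCells N n A then 1 else 0 := by
  rw [gridApprox, Finset.sum_apply]
  have h0 : ∀ k, k ≠ j → x ∉ gridCell N n k := fun k hk hxk =>
    Set.disjoint_left.1 (pairwise_disjoint_gridCell N n hk) hxk hx
  split_ifs with h
  · rw [Finset.sum_eq_single_of_mem j h fun k _ hk => Set.indicator_of_notMem (h0 k hk) _,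
      Set.indicator_of_mem hx]
  · refine Finset.sum_eq_zero fun k hk => Set.indicator_of_notMem (h0 k ?_) _
    rintro rfl
    exact h hk

theorem gridCell_subset {N n j : ℕ} (hj : j < 2 * N * (n + 1)) :
    gridCell N n j ⊆ Set.Ioc (-N : ℝ) N := by
  have hn : (0 : ℝ) < n + 1 := by positivity
  refine Set.Ioc_subset_Ioc ?_ ?_
  · unfold gridPoint
    have : (0 : ℝ) ≤ (j : ℝ) / (n + 1) := by positivity
    linarith
  · unfold gridPoint
    have : ((j + 1 : ℕ) : ℝ) / (n + 1) ≤ 2 * N := by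
      rw [div_le_iff₀ hn]
      exact_mod_cast hj
    linarith

theorem gridApprox_apply_of_notMem {N n : ℕ} {A : Set ℝ} {x : ℝ}
    (hx : x ∉ Set.Ioc (-N : ℝ) N) : gridApprox N n A x = 0 := by
  rw [gridApprox, Finset.sum_apply]
  refine Finset.sum_eq_zero fun k hk => Set.indicator_of_notMem (fun h => hx ?_) _
  exact gridCell_subset (Finset.mem_range.1 (Finset.mem_filter.1 hk).1) h

theorem abs_gridApprox_le (N n : ℕ) (A : Set ℝ) (x : ℝ) :
    |gridApprox N n A x| ≤ (Set.Ioc (-N : ℝ) N).indicator (fun _ => (1 : ℝ)) x := by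
  by_cases hx : x ∈ Set.Ioc (-N : ℝ) N
  · obtain ⟨j, -, hj⟩ := exists_mem_gridCell N n hx
    rw [gridApprox_apply_of_mem hj, Set.indicator_of_mem hx]
    split_ifs <;> simp
  · rw [gridApprox_apply_of_notMem hx, Set.indicator_of_notMem hx, abs_zero]

theorem measurable_gridApprox (N n : ℕ) (A : Set ℝ) : Measurable (gridApprox N n A) := by
  have h : ∀ j, Measurable ((gridCell N n j).indicator fun _ => (1 : ℝ)) := fun j =>
    measurable_const.indicator (isBoundedBorel_gridCell N n j).1
  unfold gridApprox
  fun_prop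

theorem ae_tendsto_gridApprox {N : ℕ} {A : Set ℝ} (hA : MeasurableSet A)
    (hAN : A ⊆ Set.Ioc (-N : ℝ) N) : ∀ᵐ x, Tendsto (fun n => gridApprox N n A x) atTop
      (𝓝 (A.indicator (fun _ => (1 : ℝ)) x)) := by
  have hd1 := (ae_restrict_iff' hA).1 (ae_eventually_Ioc_lt_two_mul A)
  have hd2 := (ae_restrict_iff' hA.compl).1 (ae_eventually_Ioc_lt_two_mul Aᶜ)
  filter_upwards [hd1, hd2] with x h1 h2
  by_cases hx : x ∈ Set.Ioc (-N : ℝ) N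
  swap
  · rw [Set.indicator_of_notMem fun h => hx (hAN h)]
    simp_rw [gridApprox_apply_of_notMem hx]
    exact tendsto_const_nhds
  choose j hjlt hj using fun n => exists_mem_gridCell N n hx
  have hlim : Tendsto (fun n => gridPoint N n (j n + 1) - gridPoint N n (j n)) atTop (𝓝 0) := by
    simp_rw [gridPoint_succ_sub]
    exact tendsto_one_div_add_atTop_nhds_zero_nat (𝕜 := ℝ)
  by_cases hxA : x ∈ A
  · rw [Set.indicator_of_mem hxA]
    refine tendsto_const_nhds.congr' ?_
    filter_upwards [h1 hxA _ _ (fun n => hj n) hlim] with n hn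
    rw [gridApprox_apply_of_mem (hj n), if_pos]
    exact Finset.mem_filter.2 ⟨Finset.mem_range.2 (hjlt n), hn⟩
  · rw [Set.indicator_of_notMem hxA]
    refine tendsto_const_nhds.congr' ?_
    filter_upwards [h2 hxA _ _ (fun n => hj n) hlim] with n hn
    rw [gridApprox_apply_of_mem (hj n), if_neg]
    intro hmem
    have h3 := (Finset.mem_filter.1 hmem).2
    have h4 : volume.real (A ∩ gridCell N n (j n)) + volume.real (Aᶜ ∩ gridCell N n (j n)) =
        volume.real (gridCell N n (j n)) := by
      rw [Set.inter_comm, Set.inter_comm Aᶜ, ← Set.sdiff_eq]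
      exact measureReal_inter_add_sdiff hA measure_Ioc_lt_top.ne
    change volume.real (gridCell N n (j n)) < 2 * volume.real (Aᶜ ∩ gridCell N n (j n)) at hn
    linarith

end Grid

section Independence

variable {Ω E : Type*} [MeasurableSpace Ω] {P : Measure Ω} [IsProbabilityMeasure P]
  [NormedAddCommGroup E] [InnerProductSpace ℝ E] [FiniteDimensional ℝ E] [MeasurableSpace E]
  [BorelSpace E] {L : ℝ → Ω → E} {σ : ℝ} {W : Lp ℝ 2 (volume : Measure ℝ) →L[ℝ] Lp E 2 P}

/-- The integrals of the indicators of disjoint bounded sets are independent: they are limits of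
sums of increments over disjoint sets of cells. -/
theorem IsItoIntegral.iIndepFun_indicator_fintype (hW : IsItoIntegral P L σ W)
    (hL : IsLevyProcess P L) {ι : Type*} [Fintype ι] {A : ι → Set ℝ}
    (hA : ∀ i, IsBoundedBorel (A i)) (hd : Pairwise (Function.onFun Disjoint A)) :
    iIndepFun (fun i => (itoIntegral W ((A i).indicator fun _ => (1 : ℝ)) : Ω → E)) P := by
  have : ProperSpace E := FiniteDimensional.proper_real E
  obtain ⟨N, hN⟩ : ∃ N : ℕ, ∀ i, A i ⊆ Set.Ioc (-N : ℝ) N := by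
    obtain ⟨r, hr⟩ := ((Bornology.isBounded_iUnion (s := A)).2
      fun i => (hA i).2).subset_closedBall 0
    obtain ⟨N, hN⟩ := exists_nat_gt r
    refine ⟨N, fun i x hx => ?_⟩
    have := hr (Set.mem_iUnion_of_mem i hx)
    rw [mem_closedBall_zero_iff, Real.norm_eq_abs, abs_le] at this
    exact ⟨by linarith, by linarith⟩
  -- independent approximations: sums of increments over the cells mostly contained in `A i`
  let X : ℕ → ι → Ω → E := fun n i ω => ∑ j ∈ majorityCells N n (A i),
    (L (gridPoint N n (j + 1)) ω - L (gridPoint N n j) ω)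
  have hXm : ∀ n i, AEMeasurable (X n i) P := fun n i =>
    (Finset.measurable_sum _ fun j _ => (hL.measurable _).sub (hL.measurable _)).aemeasurable
  have hXeq : ∀ n i, itoIntegral W (gridApprox N n (A i)) =ᵐ[P] X n i := by
    intro n i
    rw [gridApprox, itoIntegral_sum _ fun j _ =>
      memLp_indicator_one (isBoundedBorel_gridCell N n j)]
    have h1 : ∀ᵐ ω ∂P, ∀ j, itoIntegral W ((gridCell N n j).indicator fun _ => (1 : ℝ)) ω =
        L (gridPoint N n (j + 1)) ω - L (gridPoint N n j) ω :=
      ae_all_iff.2 fun j => hW.itoIntegral_Ioc (monotone_gridPoint N n j.le_succ)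
    filter_upwards [h1, Lp.coeFn_finsetSum (p := 2) (μ := P) (majorityCells N n (A i))
      fun j => itoIntegral W ((gridCell N n j).indicator fun _ => (1 : ℝ))] with ω h2 h3
    rw [h3, Finset.sum_apply]
    exact Finset.sum_congr rfl fun j _ => h2 j
  refine iIndepFun_of_tendstoInMeasure (X := X) hXm (fun n => ?_) fun i => ?_
  · refine iIndepFun_sum_of_disjoint
      (fun j => ((hL.measurable _).sub (hL.measurable _)).aemeasurable)
      (hL.indep_increments.nat (monotone_gridPoint N n)) fun i k hik => ?_
    exact disjoint_majorityCells N n (hA k).1 (hd hik)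
  · refine TendstoInMeasure.congr_left (hXeq · i) (tendstoInMeasure_of_tendsto_Lp ?_)
    exact tendsto_itoIntegral_of_dominated (fun n => measurable_gridApprox N n _)
      (measurable_const.indicator (hA i).1) (memLp_indicator_one (isBoundedBorel_Ioc (-N) N))
      (fun n => Eventually.of_forall fun x => abs_gridApprox_le N n _ x)
      (ae_tendsto_gridApprox (hA i).1 (hN i)) (memLp_indicator_one (hA i))

theorem IsItoIntegral.iIndepFun_indicator (hW : IsItoIntegral P L σ W)
    (hL : IsLevyProcess P L) {ι : Type*} {A : ι → Set ℝ}
    (hA : ∀ i, IsBoundedBorel (A i)) (hd : Pairwise (Function.onFun Disjoint A)) :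
    iIndepFun (fun i => (itoIntegral W ((A i).indicator fun _ => (1 : ℝ)) : Ω → E)) P := by
  rw [iIndepFun_iff_finset]
  intro s
  exact hW.iIndepFun_indicator_fintype hL (A := fun i : s => A i) (fun i => hA i)
    fun i j hij => hd fun h => hij (Subtype.ext h)

/-- The integrals of a simple function over two disjoint Borel sets are independent. Both are linear
combinations, over disjoint blocks of indices, of the measures of the level sets `S (b, a)`. -/
theorem IsItoIntegral.iIndepFun_restrict (hW : IsItoIntegral P L σ W)
    (hL : IsLevyProcess P L) {g : SimpleFunc ℝ ℝ} (hg : Bornology.IsBounded (Function.support g))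
    {A : Bool → Set ℝ} (hA : ∀ b, MeasurableSet (A b)) (hd : Pairwise (Function.onFun Disjoint A)) :
    iIndepFun (fun b => (itoIntegral W (g.restrict (A b)) : Ω → E)) P := by
  classical
  have : ProperSpace E := FiniteDimensional.proper_real E
  have hgA : ∀ b, Function.support (g.restrict (A b)) ⊆ Function.support g := fun b x hx => by
    rw [Function.mem_support, SimpleFunc.restrict_apply _ (hA b)] at hx
    exact fun h => hx (by simp [Set.indicator_apply, h])
  have hsub : ∀ b a, a ≠ 0 → g.restrict (A b) ⁻¹' {a} ⊆ A b := fun b a ha x hx => by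
    by_contra hxA
    rw [Set.mem_preimage, SimpleFunc.restrict_apply _ (hA b), Set.indicator_of_notMem hxA] at hx
    exact ha (Eq.symm hx)
  let S : Bool × ℝ → Set ℝ := fun p => if p.2 = 0 then ∅ else g.restrict (A p.1) ⁻¹' {p.2}
  have hS : ∀ p, IsBoundedBorel (S p) := by
    intro p
    by_cases hp : p.2 = 0
    · simp [S, hp, IsBoundedBorel]
    · simp only [S, if_neg hp]
      refine ⟨SimpleFunc.measurableSet_fiber _ _, hg.subset fun x hx => hgA p.1 ?_⟩
      rw [Function.mem_support, show g.restrict (A p.1) x = p.2 from hx]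
      exact hp
  have hSd : Pairwise (Function.onFun Disjoint S) := by
    rintro ⟨b, a⟩ ⟨b', a'⟩ hne
    by_cases ha : a = 0
    · simp [Function.onFun, S, ha]
    by_cases ha' : a' = 0
    · simp [Function.onFun, S, ha']
    simp only [Function.onFun, S, if_neg ha, if_neg ha']
    by_cases hb : b = b'
    · subst hb
      have : a ≠ a' := fun h => hne (by rw [h])
      exact Disjoint.preimage _ (by simpa using this)
    · exact (hd hb).mono (hsub b a ha) (hsub b' a' ha')
  have h1 := (hW.iIndepFun_indicator hL hS hSd).comp (fun p x => p.2 • x)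
    fun p => measurable_const_smul p.2
  have h2 := iIndepFun_sum_of_disjoint (fun p => by
      exact ((Lp.aestronglyMeasurable _).aemeasurable.const_smul p.2)) h1
    (J := fun b => {b} ×ˢ (g.restrict (A b)).range) (fun b b' hb => by
      rw [Function.onFun, Finset.disjoint_left]
      rintro ⟨c, a⟩ h3 h4
      simp only [Finset.mem_product, Finset.mem_singleton] at h3 h4
      exact hb (h3.1.symm.trans h4.1))
  refine h2.congr fun b => ?_
  rw [itoIntegral_simpleFunc (hg.subset (hgA b))]
  filter_upwards [Lp.coeFn_finsetSum (p := 2) (μ := P) (g.restrict (A b)).range fun a =>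
      a • itoIntegral W ((g.restrict (A b) ⁻¹' {a}).indicator fun _ => (1 : ℝ)),
    (ae_ball_iff (g.restrict (A b)).range.countable_toSet).2 fun a _ => Lp.coeFn_smul a
      (itoIntegral W ((g.restrict (A b) ⁻¹' {a}).indicator fun _ => (1 : ℝ)))] with ω h3 h4
  rw [h3, Finset.sum_apply, Finset.sum_product, Finset.sum_singleton]
  refine Finset.sum_congr rfl fun a ha => ?_
  rw [h4 a ha]
  rcases eq_or_ne a 0 with rfl | ha0
  · simp
  · simp [S, ha0]

end Independence

/-! ### The associated random measure: uniqueness -/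

section Uniqueness

variable {Ω E : Type*} [MeasurableSpace Ω] {P : Measure Ω} [NormedAddCommGroup E]
  [MeasurableSpace E] {L : ℝ → Ω → E} {M M' : Set ℝ → Ω → E}

theorem isBoundedBorel_empty : IsBoundedBorel ∅ := ⟨MeasurableSet.empty, Bornology.isBounded_empty⟩

theorem randomMeasure_empty (hM : IsAssociatedRandomMeasure P L M) : M ∅ =ᵐ[P] 0 := by
  have h := hM.sigma_additive (fun _ => ∅) (fun _ => isBoundedBorel_empty)
    (fun i j _ => by simp [Function.onFun]) (by simpa using isBoundedBorel_empty)
  filter_upwards [h] with ω hω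
  simp only [Finset.sum_const, Finset.card_range, Set.iUnion_empty] at hω
  have h1 := ((tendsto_add_atTop_iff_nat 1).2 hω).sub hω
  simp only [add_smul, one_smul, add_sub_cancel_left, sub_self] at h1
  exact tendsto_nhds_unique tendsto_const_nhds h1

theorem randomMeasure_union (hM : IsAssociatedRandomMeasure P L M) {A B : Set ℝ}
    (hA : IsBoundedBorel A) (hB : IsBoundedBorel B) (hAB : Disjoint A B) :
    M (A ∪ B) =ᵐ[P] M A + M B := by
  let S : ℕ → Set ℝ := fun n => if n = 0 then A else if n = 1 then B else ∅
  have hU : ⋃ n, S n = A ∪ B := by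
    ext x
    simp only [Set.mem_iUnion, Set.mem_union]
    constructor
    · rintro ⟨n, hn⟩
      by_cases h0 : n = 0
      · left; simpa [S, h0] using hn
      · by_cases h1 : n = 1
        · right; simpa [S, h1] using hn
        · simp [S, h0, h1] at hn
    · rintro (h | h)
      · exact ⟨0, by simpa [S] using h⟩
      · exact ⟨1, by simpa [S] using h⟩
  have h := hM.sigma_additive S (fun n => by
      by_cases h0 : n = 0
      · simpa [S, h0] using hA
      · by_cases h1 : n = 1
        · simpa [S, h1] using hB
        · simpa [S, h0, h1] using isBoundedBorel_empty)
    (fun i j hij => by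
      simp only [Function.onFun, S]
      split_ifs <;> first | omega | exact hAB | exact hAB.symm | simp)
    (by rw [hU]; exact ⟨hA.1.union hB.1, hA.2.union hB.2⟩)
  rw [hU] at h
  filter_upwards [h, randomMeasure_empty hM] with ω hω h0
  refine tendsto_nhds_unique hω (tendsto_const_nhds.congr' ?_)
  filter_upwards [eventually_ge_atTop 2] with n hn
  rw [← Finset.sum_subset (Finset.range_mono hn)]
  · simp [Finset.sum_range_succ, S]
  · intro k _ hk
    have hk2 : 2 ≤ k := not_lt.1 fun h => hk (Finset.mem_range.2 h)
    simp only [S, if_neg (show k ≠ 0 by omega), if_neg (show k ≠ 1 by omega)]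
    exact h0

/-- The random measure associated with a process is almost surely unique. -/
theorem randomMeasure_unique (hM : IsAssociatedRandomMeasure P L M)
    (hM' : IsAssociatedRandomMeasure P L M') {A : Set ℝ} (hA : IsBoundedBorel A) :
    M A =ᵐ[P] M' A := by
  obtain ⟨N, hN⟩ : ∃ N : ℕ, A ⊆ Set.Ioc (-N : ℝ) N := by
    obtain ⟨r, hr⟩ := hA.2.subset_closedBall 0
    obtain ⟨N, hN⟩ := exists_nat_gt r
    refine ⟨N, fun x hx => ?_⟩
    have := hr hx
    rw [mem_closedBall_zero_iff, Real.norm_eq_abs, abs_le] at this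
    exact ⟨by linarith, by linarith⟩
  have hb : ∀ B, MeasurableSet B → IsBoundedBorel (B ∩ Set.Ioc (-N : ℝ) N) := fun B hB =>
    ⟨hB.inter measurableSet_Ioc, (Metric.isBounded_Ioc _ _).subset Set.inter_subset_right⟩
  have hioc : ∀ l u, M (Set.Ioc l u) =ᵐ[P] M' (Set.Ioc l u) := by
    intro l u
    rcases le_total l u with h | h
    · exact (hM.ioc l u h).trans (hM'.ioc l u h).symm
    · rw [Set.Ioc_eq_empty (not_lt.2 h)]
      exact (randomMeasure_empty hM).trans (randomMeasure_empty hM').symm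
  have key : ∀ B, MeasurableSet B →
      M (B ∩ Set.Ioc (-N : ℝ) N) =ᵐ[P] M' (B ∩ Set.Ioc (-N : ℝ) N) := by
    intro B hB
    refine MeasurableSpace.induction_on_inter
      (C := fun B _ => M (B ∩ Set.Ioc (-N : ℝ) N) =ᵐ[P] M' (B ∩ Set.Ioc (-N : ℝ) N))
      ((borel_eq_generateFrom_Ioc ℝ) ▸ (BorelSpace.measurable_eq (α := ℝ)))
      (isPiSystem_Ioc id id) ?_ ?_ ?_ ?_ B hB
    · rw [Set.empty_inter]
      exact (randomMeasure_empty hM).trans (randomMeasure_empty hM').symm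
    · rintro t ⟨l, u, -, rfl⟩
      rw [Set.Ioc_inter_Ioc]
      exact hioc _ _
    · intro t ht h
      have hd : Disjoint (t ∩ Set.Ioc (-N : ℝ) N) (tᶜ ∩ Set.Ioc (-N : ℝ) N) :=
        disjoint_compl_right.mono Set.inter_subset_left Set.inter_subset_left
      have e : t ∩ Set.Ioc (-N : ℝ) N ∪ tᶜ ∩ Set.Ioc (-N : ℝ) N = Set.Ioc (-N : ℝ) N := by
        rw [← Set.union_inter_distrib_right, Set.union_compl_self, Set.univ_inter]
      have h1 := randomMeasure_union hM (hb t ht) (hb _ ht.compl) hd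
      have h2 := randomMeasure_union hM' (hb t ht) (hb _ ht.compl) hd
      rw [e] at h1 h2
      filter_upwards [h, h1, h2, hioc (-N) N] with ω h3 h4 h5 h6
      rw [Pi.add_apply] at h4 h5
      rw [h4, h5, h3] at h6
      exact add_left_cancel h6
    · intro S hd hS h
      rw [Set.iUnion_inter]
      have hd' : Pairwise (Function.onFun Disjoint fun n => S n ∩ Set.Ioc (-N : ℝ) N) :=
        fun i j hij => (hd hij).mono Set.inter_subset_left Set.inter_subset_left
      have hU : IsBoundedBorel (⋃ n, S n ∩ Set.Ioc (-N : ℝ) N) := by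
        rw [← Set.iUnion_inter]; exact hb _ (MeasurableSet.iUnion hS)
      filter_upwards [hM.sigma_additive _ (fun n => hb _ (hS n)) hd' hU,
        hM'.sigma_additive _ (fun n => hb _ (hS n)) hd' hU, ae_all_iff.2 h] with ω h1 h2 h3
      refine tendsto_nhds_unique h1 (h2.congr fun n => ?_)
      exact Finset.sum_congr rfl fun k _ => (h3 k).symm
  have := key A hA.1
  rwa [Set.inter_eq_left.2 hN] at this

end Uniqueness

/-! ### Almost sure convergence of series of independent variables -/

section Series

variable {Ω : Type*} [MeasurableSpace Ω] {P : Measure Ω} [IsProbabilityMeasure P]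

/-- The partial sums of independent centered variables form a martingale; so they converge almost
surely if they are bounded in `L¹`. -/
theorem ae_exists_tendsto_sum_of_iIndepFun {ξ : ℕ → Ω → ℝ} (hm : ∀ n, StronglyMeasurable (ξ n))
    (hint : ∀ n, Integrable (ξ n) P) (hc : ∀ n, ∫ ω, ξ n ω ∂P = 0) (hind : iIndepFun ξ P)
    {R : NNReal} (hR : ∀ N, eLpNorm (∑ n ∈ Finset.range N, ξ n) 1 P ≤ R) :
    ∀ᵐ ω ∂P, ∃ l, Tendsto (fun N => ∑ n ∈ Finset.range N, ξ n ω) atTop (𝓝 l) := by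
  let ℱ := Filtration.natural ξ hm
  let S : ℕ → Ω → ℝ := fun N => ∑ n ∈ Finset.range (N + 1), ξ n
  have hadp : StronglyAdapted ℱ S := by
    intro N
    refine Finset.stronglyMeasurable_sum _ fun n hn => ?_
    exact ((Filtration.stronglyAdapted_natural hm) n).mono
      (ℱ.mono (Nat.lt_succ_iff.1 (Finset.mem_range.1 hn)))
  have hS : Martingale S ℱ P := by
    refine martingale_of_condExp_sub_eq_zero_nat hadp
      (fun N => integrable_finsetSum' _ fun n _ => hint n) fun N => ?_
    have e : S (N + 1) - S N = ξ (N + 1) := by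
      simp only [S]; rw [Finset.sum_range_succ _ (N + 1), add_sub_cancel_left]
    rw [e]
    have h1 := condExp_indep_eq (m₁ := MeasurableSpace.comap (ξ (N + 1)) inferInstance)
      (hm (N + 1)).measurable.comap_le (ℱ.le N)
      (comap_measurable (ξ (N + 1))).stronglyMeasurable
      (hind.indep_comap_natural_of_lt hm N.lt_succ_self)
    rw [hc] at h1
    exact h1
  filter_upwards [hS.submartingale.ae_tendsto_limitProcess (R := R) fun N => hR (N + 1)] with ω hω
  refine ⟨_, (tendsto_add_atTop_iff_nat 1).1 (hω.congr fun N => ?_)⟩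
  simp only [S, Finset.sum_apply]

variable {E : Type*} [NormedAddCommGroup E] [InnerProductSpace ℝ E] [FiniteDimensional ℝ E]
  [MeasurableSpace E] [BorelSpace E]

/-- If a series of independent centered variables converges in `L²`, it converges almost surely to
the same limit. -/
theorem ae_tendsto_sum_of_iIndepFun {Z : ℕ → Lp E 2 P} {S : Lp E 2 P}
    (hind : iIndepFun (fun n => (Z n : Ω → E)) P) (hc : ∀ n, ∫ ω, Z n ω ∂P = 0)
    (hS : Tendsto (fun N => ∑ n ∈ Finset.range N, Z n) atTop (𝓝 S)) :
    ∀ᵐ ω ∂P, Tendsto (fun N => ∑ n ∈ Finset.range N, Z n ω) atTop (𝓝 (S ω)) := by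
  have : CompleteSpace E := FiniteDimensional.complete ℝ E
  have : ProperSpace E := FiniteDimensional.proper_real E
  let b := stdOrthonormalBasis ℝ E
  have hsum : ∀ᵐ ω ∂P, ∀ N, (∑ n ∈ Finset.range N, Z n : Lp E 2 P) ω =
      ∑ n ∈ Finset.range N, Z n ω := ae_all_iff.2 fun N => by
    filter_upwards [Lp.coeFn_finsetSum (p := 2) (μ := P) (Finset.range N) Z] with ω hω
    rw [hω, Finset.sum_apply]
  obtain ⟨C, hC⟩ := hS.norm.bddAbove_range
  have hcoord : ∀ i, ∀ᵐ ω ∂P, ∃ l,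
      Tendsto (fun N => ∑ n ∈ Finset.range N, inner ℝ (b i) (Z n ω)) atTop (𝓝 l) := by
    intro i
    refine ae_exists_tendsto_sum_of_iIndepFun (R := C.toNNReal)
      (fun n => stronglyMeasurable_const.inner (Lp.stronglyMeasurable (Z n)))
      (fun n => ((Lp.memLp (Z n)).integrable (by norm_num)).const_inner _) (fun n => ?_)
      (hind.comp (fun _ x => inner ℝ (b i) x) fun _ => by fun_prop) fun N => ?_
    · rw [integral_inner ((Lp.memLp (Z n)).integrable (by norm_num)), hc, inner_zero_right]
    · have h1 : eLpNorm (∑ n ∈ Finset.range N, fun ω => inner ℝ (b i) (Z n ω)) 1 P ≤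
          eLpNorm (∑ n ∈ Finset.range N, Z n : Lp E 2 P) 1 P := by
        refine eLpNorm_mono_ae ?_
        filter_upwards [hsum] with ω hω
        rw [hω N, Finset.sum_apply, ← inner_sum]
        refine (norm_inner_le_norm _ _).trans ?_
        rw [b.norm_eq_one, one_mul]
      refine h1.trans ((eLpNorm_le_eLpNorm_of_exponent_le (q := 2) (by norm_num)
        (Lp.aestronglyMeasurable _)).trans ?_)
      rw [← ENNReal.ofReal_toReal (Lp.eLpNorm_ne_top _), ← Lp.norm_def]
      exact ENNReal.ofReal_le_ofReal (hC ⟨N, rfl⟩)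
  obtain ⟨ns, hns, hae⟩ := (tendstoInMeasure_of_tendsto_Lp hS).exists_seq_tendsto_ae
  filter_upwards [hsum, hae, ae_all_iff.2 hcoord] with ω h1 h2 h3
  choose l hl using h3
  have h4 : Tendsto (fun N => ∑ n ∈ Finset.range N, Z n ω) atTop (𝓝 (∑ i, l i • b i)) := by
    refine (tendsto_finsetSum Finset.univ fun i _ => (hl i).smul_const (b i)).congr fun N => ?_
    simp_rw [← inner_sum]
    exact b.sum_repr' _
  have h5 : Tendsto (fun k => ∑ n ∈ Finset.range (ns k), Z n ω) atTop (𝓝 (S ω)) :=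
    h2.congr fun k => h1 (ns k)
  rwa [tendsto_nhds_unique h5 (h4.comp hns.tendsto_atTop)]

end Series

/-! ### The associated random measure: existence -/

section Existence

variable {Ω E : Type*} [MeasurableSpace Ω] {P : Measure Ω} [IsProbabilityMeasure P]
  [NormedAddCommGroup E] [InnerProductSpace ℝ E] [FiniteDimensional ℝ E] [MeasurableSpace E]
  [BorelSpace E] {L : ℝ → Ω → E} {σ : ℝ} {W : Lp ℝ 2 (volume : Measure ℝ) →L[ℝ] Lp E 2 P}

theorem sum_indicator_eq_indicator_iUnion {A : ℕ → Set ℝ} (hd : Pairwise (Function.onFun Disjoint A))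
    {x : ℝ} {k : ℕ} (hk : x ∈ A k) (N : ℕ) :
    (∑ n ∈ Finset.range N, (A n).indicator fun _ => (1 : ℝ)) x = if k < N then 1 else 0 := by
  have h0 : ∀ n, n ≠ k → (A n).indicator (fun _ => (1 : ℝ)) x = 0 := fun n hn =>
    Set.indicator_of_notMem (fun h => Set.disjoint_left.1 (hd hn) h hk) _
  rw [Finset.sum_apply]
  split_ifs with h
  · rw [Finset.sum_eq_single_of_mem k (Finset.mem_range.2 h) fun n _ hn => h0 n hn,
      Set.indicator_of_mem hk]
  · refine Finset.sum_eq_zero fun n hn => h0 n ?_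
    rintro rfl
    exact h (Finset.mem_range.1 hn)

theorem IsItoIntegral.isAssociatedRandomMeasure (hW : IsItoIntegral P L σ W)
    (hL : IsLevyProcess P L) (hL_centered : ∀ t, ∫ ω, L t ω ∂P = 0) :
    IsAssociatedRandomMeasure P L fun A => itoIntegral W (A.indicator fun _ => (1 : ℝ)) where
  measurable A _ := by
    have : ProperSpace E := FiniteDimensional.proper_real E
    exact (Lp.stronglyMeasurable _).measurable
  indep A hA hd := hW.iIndepFun_indicator hL hA hd
  ioc s t hst := hW.itoIntegral_Ioc hst
  sigma_additive A hA hd hU := by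
    refine ae_tendsto_sum_of_iIndepFun (hW.iIndepFun_indicator hL hA hd)
      (fun n => hW.integral_itoIntegral hL_centered _) ?_
    simp_rw [← fun N => itoIntegral_sum (W := W) (Finset.range N) fun n _ =>
      memLp_indicator_one (hA n)]
    have hm : ∀ n, Measurable ((A n).indicator fun _ => (1 : ℝ)) := fun n =>
      measurable_const.indicator (hA n).1
    refine tendsto_itoIntegral_of_dominated (fun N => by fun_prop)
      (measurable_const.indicator hU.1) (memLp_indicator_one hU) (fun N => ?_) ?_
      (memLp_indicator_one hU)
    · refine Eventually.of_forall fun x => ?_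
      by_cases hx : x ∈ ⋃ n, A n
      · obtain ⟨k, hk⟩ := Set.mem_iUnion.1 hx
        rw [sum_indicator_eq_indicator_iUnion hd hk, Set.indicator_of_mem hx]
        split_ifs <;> simp
      · rw [Finset.sum_apply, Finset.sum_eq_zero, abs_zero]
        · exact Set.indicator_nonneg (fun _ _ => zero_le_one) x
        · exact fun n _ => Set.indicator_of_notMem (fun h => hx (Set.mem_iUnion_of_mem n h)) _
    · refine Eventually.of_forall fun x => ?_
      by_cases hx : x ∈ ⋃ n, A n
      · obtain ⟨k, hk⟩ := Set.mem_iUnion.1 hx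
        rw [Set.indicator_of_mem hx]
        refine tendsto_const_nhds.congr' ?_
        filter_upwards [eventually_gt_atTop k] with N hN
        rw [sum_indicator_eq_indicator_iUnion hd hk, if_pos hN]
      · rw [Set.indicator_of_notMem hx]
        refine tendsto_const_nhds.congr fun N => ?_
        rw [Finset.sum_apply, Finset.sum_eq_zero]
        exact fun n _ => Set.indicator_of_notMem (fun h => hx (Set.mem_iUnion_of_mem n h)) _

theorem IsItoIntegral.simpleStochIntegral_ae_eq (hW : IsItoIntegral P L σ W)
    (hL : IsLevyProcess P L) (hL_centered : ∀ t, ∫ ω, L t ω ∂P = 0) {M : Set ℝ → Ω → E}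
    (hM : IsAssociatedRandomMeasure P L M) {g : SimpleFunc ℝ ℝ}
    (hg : Bornology.IsBounded (Function.support g)) :
    simpleStochIntegral M g =ᵐ[P] itoIntegral W g := by
  rw [itoIntegral_simpleFunc hg]
  have h1 : ∀ a ∈ g.range, a ≠ 0 → M (g ⁻¹' {a}) =ᵐ[P]
      itoIntegral W ((g ⁻¹' {a}).indicator fun _ => (1 : ℝ)) := fun a _ ha =>
    randomMeasure_unique hM (hW.isAssociatedRandomMeasure hL hL_centered)
      ⟨g.measurableSet_fiber a, hg.subset fun x hx => by
        rw [Function.mem_support, show g x = a from hx]; exact ha⟩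
  have h2 : ∀ a ∈ g.range, ∀ᵐ ω ∂P, a • M (g ⁻¹' {a}) ω =
      (a • itoIntegral W ((g ⁻¹' {a}).indicator fun _ => (1 : ℝ)) : Lp E 2 P) ω := by
    intro a ha
    rcases eq_or_ne a 0 with rfl | ha0
    · filter_upwards [Lp.coeFn_smul (0 : ℝ)
        (itoIntegral W ((g ⁻¹' {0}).indicator fun _ => (1 : ℝ)))] with ω h
      rw [h, zero_smul, zero_smul, Pi.zero_apply]
    · filter_upwards [h1 a ha ha0, Lp.coeFn_smul a
        (itoIntegral W ((g ⁻¹' {a}).indicator fun _ => (1 : ℝ)))] with ω h h'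
      rw [h, h', Pi.smul_apply]
  filter_upwards [Lp.coeFn_finsetSum (p := 2) (μ := P) g.range fun a =>
      a • itoIntegral W ((g ⁻¹' {a}).indicator fun _ => (1 : ℝ)),
    (ae_ball_iff g.range.countable_toSet).2 h2] with ω h3 h4
  rw [h3, Finset.sum_apply, simpleStochIntegral]
  exact Finset.sum_congr rfl fun a ha => h4 a ha

end Existence

/-! ### Approximating sequences of simple functions -/

theorem isBounded_support_restrict {g : SimpleFunc ℝ ℝ}
    (hg : Bornology.IsBounded (Function.support g)) {A : Set ℝ} (hA : MeasurableSet A) :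
    Bornology.IsBounded (Function.support (g.restrict A)) := by
  refine hg.subset fun x hx => ?_
  rw [Function.mem_support, SimpleFunc.restrict_apply _ hA] at hx
  exact fun h => hx (by simp [h])

/-- Every a.e. convergent sequence of functions is dominated a.e. by a function with values in `ℕ`,
which can be chosen to have bounded sublevel sets. -/
theorem exists_level {g : ℕ → SimpleFunc ℝ ℝ} {f : ℝ → ℝ}
    (hlim : ∀ᵐ x, Tendsto (fun n => g n x) atTop (𝓝 (f x))) :
    ∃ k : ℝ → ℕ, Measurable k ∧ (∀ x, |x| ≤ k x) ∧ ∀ᵐ x, ∀ n, |g n x| ≤ k x := by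
  refine ⟨fun x => ⌈max (⨆ n, |g n x|) |x|⌉₊, ?_, fun x => ?_, ?_⟩
  · refine Nat.measurable_ceil.comp (Measurable.max (Measurable.iSup fun n => ?_) measurable_norm)
    exact (g n).measurable.norm
  · exact (le_max_right _ _).trans (Nat.le_ceil _)
  · filter_upwards [hlim] with x hx n
    exact ((le_ciSup hx.abs.bddAbove_range n).trans (le_max_left _ _)).trans (Nat.le_ceil _)

section Restriction

variable {Ω E : Type*} [MeasurableSpace Ω] {P : Measure Ω} [NormedAddCommGroup E]
  [InnerProductSpace ℝ E] {W : Lp ℝ 2 (volume : Measure ℝ) →L[ℝ] Lp E 2 P}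
  {g : ℕ → SimpleFunc ℝ ℝ} {f : ℝ → ℝ} {k : ℝ → ℕ}

theorem measurableSet_level (hk : Measurable k) (s : Set ℕ) : MeasurableSet (k ⁻¹' s) :=
  hk (MeasurableSet.of_discrete (s := s))

/-- On the set where `k < K`, the approximating functions are uniformly bounded with bounded
support, so that their integrals converge in `L²`. -/
theorem tendsto_itoIntegral_restrict_level (hf : Measurable f)
    (hlim : ∀ᵐ x, Tendsto (fun n => g n x) atTop (𝓝 (f x))) (hk : Measurable k)
    (hkx : ∀ x, |x| ≤ k x) (hkg : ∀ᵐ x, ∀ n, |g n x| ≤ k x) (K : ℕ) :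
    MemLp ((k ⁻¹' Set.Iio K).indicator f) 2 volume ∧
    Tendsto (fun n => itoIntegral W ((g n).restrict (k ⁻¹' Set.Iio K))) atTop
      (𝓝 (itoIntegral W ((k ⁻¹' Set.Iio K).indicator f))) := by
  have hA := measurableSet_level hk (Set.Iio K)
  have hb : Bornology.IsBounded (k ⁻¹' Set.Iio K) := by
    refine (Metric.isBounded_Icc (-K : ℝ) K).subset fun x hx => ?_
    have : (k x : ℝ) ≤ K := by exact_mod_cast (le_of_lt hx : k x ≤ K)
    exact abs_le.1 ((hkx x).trans this)
  have hG : MemLp ((k ⁻¹' Set.Iio K).indicator fun _ => (K : ℝ)) 2 volume :=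
    memLp_indicator_const 2 hA _ (Or.inr hb.measure_lt_top.ne)
  have hgb : ∀ᵐ x, ∀ n, |(k ⁻¹' Set.Iio K).indicator (g n) x| ≤
      (k ⁻¹' Set.Iio K).indicator (fun _ => (K : ℝ)) x := by
    filter_upwards [hkg] with x hx n
    by_cases hxA : x ∈ k ⁻¹' Set.Iio K
    · rw [Set.indicator_of_mem hxA, Set.indicator_of_mem hxA]
      have : (k x : ℝ) ≤ K := by exact_mod_cast (le_of_lt hxA : k x ≤ K)
      exact (hx n).trans this
    · simp [hxA]
  have hgl : ∀ᵐ x, Tendsto (fun n => (k ⁻¹' Set.Iio K).indicator (g n) x) atTop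
      (𝓝 ((k ⁻¹' Set.Iio K).indicator f x)) := by
    filter_upwards [hlim] with x hx
    by_cases hxA : x ∈ k ⁻¹' Set.Iio K
    · simp_rw [Set.indicator_of_mem hxA]; exact hx
    · simp_rw [Set.indicator_of_notMem hxA]; exact tendsto_const_nhds
  have hmem : MemLp ((k ⁻¹' Set.Iio K).indicator f) 2 volume := by
    refine hG.mono' (hf.indicator hA).aestronglyMeasurable ?_
    filter_upwards [hgb, hgl] with x h1 h2
    exact le_of_tendsto h2.abs (Eventually.of_forall h1)
  refine ⟨hmem, ?_⟩
  simp_rw [SimpleFunc.coe_restrict _ hA]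
  exact tendsto_itoIntegral_of_dominated (fun n => (g n).measurable.indicator hA)
    (hf.indicator hA) hG (fun n => hgb.mono fun x hx => hx n) hgl hmem

theorem itoIntegral_restrict_add_compl {g : SimpleFunc ℝ ℝ}
    (hg : Bornology.IsBounded (Function.support g)) {A B C : Set ℝ} (hA : MeasurableSet A)
    (hB : MeasurableSet B) (hd : Disjoint A B) (hC : A ∪ B = C) :
    itoIntegral W (g.restrict C) =
      itoIntegral W (g.restrict A) + itoIntegral W (g.restrict B) := by
  subst hC
  rw [← itoIntegral_add (memLp_simpleFunc (isBounded_support_restrict hg hA))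
    (memLp_simpleFunc (isBounded_support_restrict hg hB)), SimpleFunc.coe_restrict _ hA,
    SimpleFunc.coe_restrict _ hB, SimpleFunc.coe_restrict _ (hA.union hB),
    Set.indicator_union_of_disjoint hd]
  rfl

/-- The integral of a simple function over the set `{x | S (k x)}` depends continuously on the
point `S` of the Cantor space. -/
theorem continuous_itoIntegral_restrict_preimage (hk : Measurable k) {g : SimpleFunc ℝ ℝ}
    (hg : Bornology.IsBounded (Function.support g)) :
    Continuous fun S : ℕ → Bool => itoIntegral W (g.restrict (k ⁻¹' {j | S j = true})) := by
  refine continuous_iff_continuousAt.2 fun S₀ => ?_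
  have hm : ∀ S : ℕ → Bool, MeasurableSet (k ⁻¹' {j | S j = true}) := fun S =>
    measurableSet_level hk _
  refine tendsto_itoIntegral_of_dominated (fun S => SimpleFunc.measurable _)
    (SimpleFunc.measurable _) (G := fun x => |g x|) (memLp_simpleFunc hg).abs
    (fun S => Eventually.of_forall fun x => ?_) (Eventually.of_forall fun x => ?_)
    (memLp_simpleFunc (isBounded_support_restrict hg (hm S₀)))
  · rw [SimpleFunc.restrict_apply _ (hm S)]
    by_cases hx : x ∈ k ⁻¹' {j | S j = true}
    · rw [Set.indicator_of_mem hx]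
    · rw [Set.indicator_of_notMem hx, abs_zero]; exact abs_nonneg _
  · refine tendsto_const_nhds.congr' ?_
    have h1 : ∀ᶠ S in 𝓝 S₀, S (k x) = S₀ (k x) :=
      ((continuous_apply (k x)).tendsto S₀).eventually ((isOpen_discrete {S₀ (k x)}).mem_nhds rfl)
    filter_upwards [h1] with S hS
    rw [SimpleFunc.restrict_apply _ (hm S), SimpleFunc.restrict_apply _ (hm S₀)]
    simp [Set.indicator_apply, hS]

/-- A Vitali–Hahn–Saks type statement: if the integrals of `g n` over every Borel set converge in
probability, then the integrals over the sets `{K ≤ k}`, which decrease to the empty set, are small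
uniformly in `n`. -/
theorem eventually_truncatedMean_tail_le [IsProbabilityMeasure P]
    (hg : ∀ n, Bornology.IsBounded (Function.support (g n)))
    (hk : Measurable k)
    (hconv : ∀ A : Set ℝ, MeasurableSet A → ∃ Z : Ω → E,
      TendstoInMeasure P (fun n => itoIntegral W ((g n).restrict A)) atTop Z)
    {ε : ℝ≥0∞} (hε : 0 < ε) :
    ∀ᶠ K : ℕ in atTop, ∀ᶠ n in atTop,
      truncatedMean P (itoIntegral W ((g n).restrict (k ⁻¹' Set.Ici K)) : Ω → E) ≤
        ε + ε + ε := by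
  -- the closed sets `F j` cover the Cantor space, so one of them contains a neighbourhood
  let I : ℕ → (ℕ → Bool) → Lp E 2 P := fun n S =>
    itoIntegral W ((g n).restrict (k ⁻¹' {j | S j = true}))
  have hI : ∀ n, Continuous (I n) := fun n => continuous_itoIntegral_restrict_preimage hk (hg n)
  let F : ℕ → Set (ℕ → Bool) := fun j =>
    {S | ∀ n ≥ j, truncatedMean P ((I n S - I j S : Lp E 2 P) : Ω → E) ≤ ε}
  have hF : ∀ j, IsClosed (F j) := by
    intro j
    have : F j = ⋂ n, ⋂ (_ : n ≥ j), (fun S => I n S - I j S) ⁻¹'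
        {Z | truncatedMean P (Z : Ω → E) ≤ ε} := by
      ext S; simp [F]
    rw [this]
    exact isClosed_iInter fun n => isClosed_iInter fun _ =>
      (isClosed_truncatedMean_le ε).preimage ((hI n).sub (hI j))
  have hFU : ⋃ j, F j = Set.univ := by
    refine Set.eq_univ_of_forall fun S => ?_
    obtain ⟨Z, hZ⟩ := hconv _ (measurableSet_level hk {j | S j = true})
    have h1 := truncatedMean_tendsto_zero hZ fun n => Lp.aestronglyMeasurable _
    obtain ⟨j, hj⟩ := (ENNReal.tendsto_atTop_zero.1 h1) (ε / 2) (ENNReal.half_pos hε.ne')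
    have hZm : AEStronglyMeasurable Z P :=
      hZ.aestronglyMeasurable fun n => Lp.aestronglyMeasurable _
    refine Set.mem_iUnion.2 ⟨j, fun n hn => ?_⟩
    have e : ((I n S - I j S : Lp E 2 P) : Ω → E) =ᵐ[P] (I n S - Z) + -(I j S - Z) := by
      filter_upwards [Lp.coeFn_sub (I n S) (I j S)] with ω hω
      rw [hω]
      simp
    rw [truncatedMean_congr e]
    refine (truncatedMean_add_le ((Lp.aestronglyMeasurable _).sub hZm)).trans ?_
    rw [truncatedMean_neg]
    exact (add_le_add (hj n hn) (hj j le_rfl)).trans (ENNReal.add_halves ε).le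
  obtain ⟨j, S₀, hS₀⟩ := nonempty_interior_of_iUnion_of_closed hF hFU
  -- points of the Cantor space which agree with `S₀` before `K` and are constant afterwards
  let T : Bool → ℕ → ℕ → Bool := fun b K i => if i < K then S₀ i else b
  have hT : ∀ b, Tendsto (T b) atTop (𝓝 S₀) := by
    intro b
    refine tendsto_pi_nhds.2 fun i => tendsto_const_nhds.congr' ?_
    filter_upwards [eventually_gt_atTop i] with K hK
    simp [T, hK]
  have hTF : ∀ b, ∀ᶠ K in atTop, T b K ∈ F j := fun b =>
    (hT b).eventually (mem_interior_iff_mem_nhds.1 hS₀)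
  have hdiff : ∀ n K, itoIntegral W ((g n).restrict (k ⁻¹' Set.Ici K)) =
      I n (T true K) - I n (T false K) := by
    intro n K
    rw [eq_sub_iff_add_eq]
    refine (itoIntegral_restrict_add_compl (hg n) (measurableSet_level hk _)
      (measurableSet_level hk _) (Disjoint.preimage k ?_) ?_).symm
    · refine Set.disjoint_left.2 fun i (h1 : K ≤ i) h2 => ?_
      simp [T, not_lt.2 h1] at h2
    · rw [← Set.preimage_union]
      congr 1
      ext i
      by_cases hi : i < K
      · simp [T, hi]
      · simp [T, hi, not_lt.1 hi]
  have htail : ∀ᶠ K in atTop,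
      truncatedMean P (itoIntegral W ((g j).restrict (k ⁻¹' Set.Ici K)) : Ω → E) ≤ ε := by
    have h1 : Tendsto (fun K => I j (T true K) - I j (T false K)) atTop (𝓝 0) := by
      simpa using (((hI j).tendsto S₀).comp (hT true)).sub (((hI j).tendsto S₀).comp (hT false))
    have h2 := ENNReal.tendsto_ofReal h1.norm
    rw [norm_zero, ENNReal.ofReal_zero] at h2
    filter_upwards [h2.eventually (ge_mem_nhds hε)] with K hK
    rw [hdiff]
    exact (truncatedMean_le_norm _).trans hK
  filter_upwards [hTF true, hTF false, htail] with K h1 h2 h3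
  filter_upwards [eventually_ge_atTop j] with n hn
  have e : itoIntegral W ((g n).restrict (k ⁻¹' Set.Ici K)) =
      (I n (T true K) - I j (T true K)) + (I j (T false K) - I n (T false K)) +
        itoIntegral W ((g j).restrict (k ⁻¹' Set.Ici K)) := by
    rw [hdiff, hdiff]; abel
  rw [e]
  refine (truncatedMean_add_le_Lp _ _).trans (add_le_add ?_ h3)
  refine (truncatedMean_add_le_Lp _ _).trans (add_le_add (h1 n hn) ?_)
  rw [truncatedMean_sub_comm_Lp]
  exact h2 n hn

end Restriction

/-! ### Integrable functions and their stochastic integrals -/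

section StochIntegral

variable {Ω E : Type*} [MeasurableSpace Ω] {P : Measure Ω} [IsProbabilityMeasure P]
  [NormedAddCommGroup E] [InnerProductSpace ℝ E] [FiniteDimensional ℝ E] [MeasurableSpace E]
  [BorelSpace E] {L : ℝ → Ω → E} {σ : ℝ} {W : Lp ℝ 2 (volume : Measure ℝ) →L[ℝ] Lp E 2 P}

/-- A square integrable function is integrable, and its stochastic integral is the Itô integral. -/
theorem IsItoIntegral.hasStochIntegral (hW : IsItoIntegral P L σ W)
    (hL : IsLevyProcess P L) (hL_centered : ∀ t, ∫ ω, L t ω ∂P = 0) {f : ℝ → ℝ}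
    (hf : Measurable f) (hf_sq : MemLp f 2 volume) :
    HasStochIntegral P L f (itoIntegral W f) := by
  have hM := hW.isAssociatedRandomMeasure hL hL_centered
  let a : ℕ → SimpleFunc ℝ ℝ := fun n =>
    SimpleFunc.approxOn f hf Set.univ 0 (Set.mem_univ 0) n
  let J : ℕ → Set ℝ := fun n => Set.Ioc (-n : ℝ) n
  have hJ : ∀ n, MeasurableSet (J n) := fun n => measurableSet_Ioc
  let g : ℕ → SimpleFunc ℝ ℝ := fun n => (a n).restrict (J n)
  have hgx : ∀ n x, g n x = (J n).indicator (a n) x := fun n x =>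
    SimpleFunc.restrict_apply _ (hJ n) x
  have hg : ∀ n, Bornology.IsBounded (Function.support (g n)) := fun n => by
    refine (Metric.isBounded_Ioc (-n : ℝ) n).subset fun x hx => ?_
    by_contra h
    exact hx (by rw [hgx, Set.indicator_of_notMem h])
  have hbound : ∀ n x, |g n x| ≤ |f x| + |f x| := fun n x => by
    rw [hgx]
    by_cases hx : x ∈ J n
    · rw [Set.indicator_of_mem hx]
      exact SimpleFunc.norm_approxOn_zero_le hf (Set.mem_univ 0) x n
    · rw [Set.indicator_of_notMem hx, abs_zero]; positivity
  have hlim : ∀ x, Tendsto (fun n => g n x) atTop (𝓝 (f x)) := fun x => by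
    have h1 : Tendsto (fun n => a n x) atTop (𝓝 (f x)) :=
      SimpleFunc.tendsto_approxOn hf (Set.mem_univ 0) (by simp)
    refine h1.congr' ?_
    obtain ⟨N, hN⟩ := exists_nat_gt |x|
    filter_upwards [eventually_ge_atTop N] with n hn
    have hn' : (N : ℝ) ≤ n := by exact_mod_cast hn
    have := abs_lt.1 (hN.trans_le hn')
    rw [hgx, Set.indicator_of_mem (show x ∈ J n from ⟨this.1, this.2.le⟩)]
  have hG : MemLp (fun x => |f x| + |f x|) 2 volume := hf_sq.abs.add hf_sq.abs
  have key : ∀ A, MeasurableSet A → TendstoInMeasure P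
      (fun n => simpleStochIntegral (fun A => (itoIntegral W (A.indicator fun _ => (1 : ℝ)) : Ω → E))
        ((g n).restrict A)) atTop (itoIntegral W (A.indicator f)) := by
    intro A hA
    refine TendstoInMeasure.congr_left (fun n => (hW.simpleStochIntegral_ae_eq hL hL_centered hM
      (isBounded_support_restrict (hg n) hA)).symm) (tendstoInMeasure_of_tendsto_Lp ?_)
    refine tendsto_itoIntegral_of_dominated (fun n => SimpleFunc.measurable _) (hf.indicator hA) hG
      (fun n => Eventually.of_forall fun x => ?_) (Eventually.of_forall fun x => ?_)
      (hf_sq.indicator hA)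
    · rw [SimpleFunc.restrict_apply _ hA]
      by_cases hx : x ∈ A
      · rw [Set.indicator_of_mem hx]; exact hbound n x
      · rw [Set.indicator_of_notMem hx, abs_zero]; positivity
    · simp_rw [SimpleFunc.restrict_apply _ hA]
      by_cases hx : x ∈ A
      · simp_rw [Set.indicator_of_mem hx]; exact hlim x
      · simp_rw [Set.indicator_of_notMem hx]; exact tendsto_const_nhds
  refine ⟨_, hM, g, hg, Eventually.of_forall hlim, fun A hA => ⟨_, key A hA⟩, ?_⟩
  simpa using key Set.univ MeasurableSet.univ

variable {g : ℕ → SimpleFunc ℝ ℝ} {f : ℝ → ℝ} {k : ℝ → ℕ}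

/-- The definition of the stochastic integral in terms of the Itô integral. -/
theorem IsItoIntegral.exists_of_hasStochIntegral (hW : IsItoIntegral P L σ W)
    (hL : IsLevyProcess P L) (hL_centered : ∀ t, ∫ ω, L t ω ∂P = 0) {Y : Ω → E}
    (hY : HasStochIntegral P L f Y) :
    ∃ g : ℕ → SimpleFunc ℝ ℝ, (∀ n, Bornology.IsBounded (Function.support (g n))) ∧
      (∀ᵐ s, Tendsto (fun n => g n s) atTop (𝓝 (f s))) ∧
      (∀ A : Set ℝ, MeasurableSet A → ∃ Z : Ω → E,
        TendstoInMeasure P (fun n => itoIntegral W ((g n).restrict A)) atTop Z) ∧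
      TendstoInMeasure P (fun n => itoIntegral W (g n)) atTop Y := by
  obtain ⟨M, hM, g, hg, hlim, hA, hgY⟩ := hY
  refine ⟨g, hg, hlim, fun A hA' => ?_, hgY.congr_left fun n =>
    hW.simpleStochIntegral_ae_eq hL hL_centered hM (hg n)⟩
  obtain ⟨Z, hZ⟩ := hA A hA'
  exact ⟨Z, hZ.congr_left fun n => hW.simpleStochIntegral_ae_eq hL hL_centered hM
    (isBounded_support_restrict (hg n) hA')⟩

/-- If a function is integrable with a square integrable stochastic integral, then it is square
integrable: the integral over a set where `f` is bounded is independent of the integral over the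
complement, so that its variance is at most that of the whole integral. -/
theorem IsItoIntegral.memLp_of_hasStochIntegral (hW : IsItoIntegral P L σ W)
    (hL : IsLevyProcess P L) (hL_centered : ∀ t, ∫ ω, L t ω ∂P = 0) (hf : Measurable f)
    {Y : Ω → E} (hY : HasStochIntegral P L f Y) (hY_sq : MemLp Y 2 P) : MemLp f 2 volume := by
  have : ProperSpace E := FiniteDimensional.proper_real E
  obtain ⟨g, hg, hlim, hA, hgY⟩ := hW.exists_of_hasStochIntegral hL hL_centered hY
  obtain ⟨k, hk, hkx, hkg⟩ := exists_level hlim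
  have hbound : ∀ K : ℕ, eLpNorm ((k ⁻¹' Set.Iio K).indicator f) 2 volume ≤
      ENNReal.ofReal (√(∫ ω, ‖Y ω‖ ^ 2 ∂P) / σ) := by
    intro K
    let B : Bool → Set ℝ := fun b => k ⁻¹' (if b then Set.Iio K else Set.Ici K)
    have hB : ∀ b, MeasurableSet (B b) := fun b => measurableSet_level hk _
    have hd : Disjoint (B true) (B false) :=
      Disjoint.preimage k (Set.disjoint_left.2 fun a (h1 : a < K) (h2 : K ≤ a) => by omega)
    have hd' : Pairwise (Function.onFun Disjoint B) := by
      rintro (_ | _) (_ | _) h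
      · exact absurd rfl h
      · exact hd.symm
      · exact hd
      · exact absurd rfl h
    obtain ⟨hmem, hU⟩ := tendsto_itoIntegral_restrict_level (W := W) hf hlim hk hkx hkg K
    obtain ⟨V, hV⟩ := hA _ (hB false)
    set U : Lp E 2 P := itoIntegral W ((k ⁻¹' Set.Iio K).indicator f) with hUdef
    have hU' : TendstoInMeasure P (fun n => itoIntegral W ((g n).restrict (B true))) atTop U :=
      tendstoInMeasure_of_tendsto_Lp hU
    let UV : Bool → Ω → E := fun b => if b then U else V
    have hind : iIndepFun UV P := by
      refine iIndepFun_of_tendstoInMeasure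
        (X := fun n b => itoIntegral W ((g n).restrict (B b)))
        (fun n b => (Lp.aestronglyMeasurable _).aemeasurable)
        (fun n => hW.iIndepFun_restrict hL (hg n) hB hd') ?_
      rintro (_ | _)
      · exact hV
      · exact hU'
    have hUV : IndepFun U V P := hind.indepFun (i := true) (j := false) (by simp)
    have hYUV : Y =ᵐ[P] U + V := by
      refine tendstoInMeasure_ae_unique hgY
        ((tendstoInMeasure_add hU' hV).congr_left fun n => ?_)
      have h1 := itoIntegral_restrict_add_compl (W := W) (hg n) (hB true) (hB false) hd
        (C := Set.univ) (by simp only [B]; rw [← Set.preimage_union]; simp)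
      rw [SimpleFunc.restrict_univ] at h1
      rw [h1]
      exact (Lp.coeFn_add _ _).symm
    have hV_sq : MemLp V 2 P := by
      refine (hY_sq.sub (Lp.memLp U)).ae_eq ?_
      filter_upwards [hYUV] with ω hω
      simp [hω]
    have hvar := integral_norm_add_sq_of_indepFun hUV (Lp.memLp U) hV_sq
      (hW.integral_itoIntegral hL_centered _)
    have hle : ‖U‖ ^ 2 ≤ ∫ ω, ‖Y ω‖ ^ 2 ∂P := by
      have h1 : ∫ ω, ‖Y ω‖ ^ 2 ∂P = ∫ ω, ‖U ω + V ω‖ ^ 2 ∂P :=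
        integral_congr_ae (by filter_upwards [hYUV] with ω hω; rw [hω, Pi.add_apply])
      have h2 : 0 ≤ ∫ ω, ‖V ω‖ ^ 2 ∂P := integral_nonneg fun ω => by positivity
      have h3 : ‖U‖ ^ 2 = ∫ ω, ‖U ω‖ ^ 2 ∂P := by
        rw [← real_inner_self_eq_norm_sq, L2.inner_def]
        simp_rw [real_inner_self_eq_norm_sq]
      rw [h1, hvar, h3]; linarith
    have hn := hW.norm_itoIntegral hmem
    rw [← hUdef] at hn
    rw [← ENNReal.ofReal_toReal hmem.eLpNorm_ne_top]
    refine ENNReal.ofReal_le_ofReal ?_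
    rw [le_div_iff₀ hW.pos, mul_comm, ← hn]
    exact Real.le_sqrt_of_sq_le hle
  refine ⟨hf.aestronglyMeasurable, ?_⟩
  have hfatou := Lp.eLpNorm_lim_le_liminf_eLpNorm (p := 2) (μ := volume)
    (f := fun K : ℕ => (k ⁻¹' Set.Iio K).indicator f)
    (fun K => (hf.indicator (measurableSet_level hk _)).aestronglyMeasurable) f
    (Eventually.of_forall fun x => by
      refine tendsto_const_nhds.congr' ?_
      filter_upwards [eventually_gt_atTop (k x)] with K hK
      rw [Set.indicator_of_mem (show x ∈ k ⁻¹' Set.Iio K from hK)])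
  refine hfatou.trans_lt
    (lt_of_le_of_lt ?_ (ENNReal.ofReal_lt_top (r := √(∫ ω, ‖Y ω‖ ^ 2 ∂P) / σ)))
  exact liminf_le_of_le (by isBoundedDefault) fun b hb =>
    let ⟨K, hK⟩ := hb.exists
    hK.trans (hbound K)

/-! ### Uniqueness of the stochastic integral -/

/-- The stochastic integral of a square integrable function is its Itô integral, for every choice
of the approximating simple functions. -/
theorem IsItoIntegral.ae_eq_of_hasStochIntegral (hW : IsItoIntegral P L σ W)
    (hL : IsLevyProcess P L) (hL_centered : ∀ t, ∫ ω, L t ω ∂P = 0) (hf : Measurable f)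
    (hf_sq : MemLp f 2 volume) {Y : Ω → E} (hY : HasStochIntegral P L f Y) :
    Y =ᵐ[P] itoIntegral W f := by
  obtain ⟨g, hg, hlim, hconv, hgY⟩ := hW.exists_of_hasStochIntegral hL hL_centered hY
  obtain ⟨k, hk, hkx, hkg⟩ := exists_level hlim
  have hYm : AEStronglyMeasurable Y P :=
    hgY.aestronglyMeasurable fun n => Lp.aestronglyMeasurable _
  have hbulk : Tendsto (fun K : ℕ => itoIntegral W ((k ⁻¹' Set.Iio K).indicator f)) atTop
      (𝓝 (itoIntegral W f)) := by
    refine tendsto_itoIntegral_of_dominated (fun K => hf.indicator (measurableSet_level hk _)) hf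
      (G := fun x => |f x|) hf_sq.abs (fun K => Eventually.of_forall fun x => ?_)
      (Eventually.of_forall fun x => ?_) hf_sq
    · by_cases hx : x ∈ k ⁻¹' Set.Iio K
      · rw [Set.indicator_of_mem hx]
      · rw [Set.indicator_of_notMem hx, abs_zero]; exact abs_nonneg _
    · refine tendsto_const_nhds.congr' ?_
      filter_upwards [eventually_gt_atTop (k x)] with K hK
      rw [Set.indicator_of_mem (show x ∈ k ⁻¹' Set.Iio K from hK)]
  have hsmall : ∀ {Z : ℕ → Lp E 2 P} {Z₀ : Lp E 2 P} {ε : ℝ≥0∞}, 0 < ε →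
      Tendsto Z atTop (𝓝 Z₀) →
        ∀ᶠ n in atTop, truncatedMean P ((Z n - Z₀ : Lp E 2 P) : Ω → E) ≤ ε := by
    intro Z Z₀ ε hε h
    have h1 := ENNReal.tendsto_ofReal (tendsto_sub_nhds_zero_iff.2 h).norm
    rw [norm_zero, ENNReal.ofReal_zero] at h1
    filter_upwards [h1.eventually (ge_mem_nhds hε)] with n hn
    exact (truncatedMean_le_norm _).trans hn
  have key : ∀ ε : ℝ≥0∞, 0 < ε → truncatedMean P (Y - (itoIntegral W f : Ω → E)) ≤
      ε + (ε + ε + (ε + ε + ε)) := by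
    intro ε hε
    obtain ⟨K, hK1, hK2⟩ := ((hsmall hε hbulk).and
      (eventually_truncatedMean_tail_le hg hk hconv hε)).exists
    obtain ⟨n, ⟨hn1, hn2⟩, hn3⟩ := (((hsmall hε (tendsto_itoIntegral_restrict_level (W := W) hf hlim
      hk hkx hkg K).2).and hK2).and ((truncatedMean_tendsto_zero hgY fun n =>
      Lp.aestronglyMeasurable _).eventually (ge_mem_nhds hε))).exists
    have hsplit := itoIntegral_restrict_add_compl (W := W) (hg n)
      (measurableSet_level hk (Set.Iio K)) (measurableSet_level hk (Set.Ici K))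
      (Disjoint.preimage k (Set.disjoint_left.2 fun a (h1 : a < K) (h2 : K ≤ a) => by omega))
      (C := Set.univ) (by rw [← Set.preimage_union]; simp)
    rw [SimpleFunc.restrict_univ] at hsplit
    set U := itoIntegral W ((g n).restrict (k ⁻¹' Set.Iio K))
    set V := itoIntegral W ((g n).restrict (k ⁻¹' Set.Ici K))
    set U₀ := itoIntegral W ((k ⁻¹' Set.Iio K).indicator f)
    set F := itoIntegral W f
    have e1 : Y - (F : Ω → E) =ᵐ[P] -((itoIntegral W (g n) : Ω → E) - Y) +
        (((U - U₀) + (U₀ - F) + V : Lp E 2 P) : Ω → E) := by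
      have e2 : (U - U₀) + (U₀ - F) + V = itoIntegral W (g n) - F := by rw [hsplit]; abel
      rw [e2]
      filter_upwards [Lp.coeFn_sub (itoIntegral W (g n)) F] with ω hω
      rw [Pi.add_apply, hω]
      simp
    rw [truncatedMean_congr e1]
    refine (truncatedMean_add_le ((Lp.aestronglyMeasurable _).sub hYm).neg).trans ?_
    rw [truncatedMean_neg]
    refine add_le_add hn3 ((truncatedMean_add_le_Lp _ _).trans (add_le_add ?_ hn2))
    exact (truncatedMean_add_le_Lp _ _).trans (add_le_add hn1 hK1)
  have hzero : truncatedMean P (Y - (itoIntegral W f : Ω → E)) = 0 := by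
    have h1 : Tendsto (fun n : ℕ => ((n : ℝ≥0∞) + 1)⁻¹) atTop (𝓝 0) := by
      have := (tendsto_add_atTop_iff_nat 1).2 ENNReal.tendsto_inv_nat_nhds_zero
      simpa using this
    have h2 := h1.add ((h1.add h1).add ((h1.add h1).add h1))
    simp only [add_zero] at h2
    refine le_antisymm (ge_of_tendsto' h2 fun n => key _ ?_) (zero_le)
    simp
  have := ae_eq_zero_of_truncatedMean_eq_zero (hYm.sub (Lp.aestronglyMeasurable _)) hzero
  filter_upwards [this] with ω hω
  exact sub_eq_zero.1 hω

end StochIntegral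

/-! ### Density of translates in `L²` -/

section Translates

/-- The isometry of `L²(ℝ; ℂ)` which maps `g` to `s ↦ g (t - s)`. -/
noncomputable def reflectTranslate (t : ℝ) :
    Lp ℂ 2 (volume : Measure ℝ) →ₗᵢ[ℂ] Lp ℂ 2 (volume : Measure ℝ) :=
  Lp.compMeasurePreservingₗᵢ ℂ (fun s => t - s) (Measure.measurePreserving_sub_left volume t)

theorem coeFn_reflectTranslate (t : ℝ) (g : Lp ℂ 2 (volume : Measure ℝ)) :
    reflectTranslate t g =ᵐ[volume] fun s => g (t - s) :=
  Lp.coeFn_compMeasurePreserving g (Measure.measurePreserving_sub_left volume t)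

theorem ae_eq_mul_of_tendsto {Z Z' : ℕ → Lp ℂ 2 (volume : Measure ℝ)}
    {Z₀ Z₀' : Lp ℂ 2 (volume : Measure ℝ)} {m : ℝ → ℂ} (hZ : Tendsto Z atTop (𝓝 Z₀))
    (hZ' : Tendsto Z' atTop (𝓝 Z₀')) (h : ∀ n, Z n =ᵐ[volume] fun ξ => m ξ * Z' n ξ) :
    Z₀ =ᵐ[volume] fun ξ => m ξ * Z₀' ξ := by
  obtain ⟨ns, hns, h1⟩ := (tendstoInMeasure_of_tendsto_Lp hZ).exists_seq_tendsto_ae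
  obtain ⟨ms, hms, h2⟩ := (tendstoInMeasure_of_tendsto_Lp
    (hZ'.comp hns.tendsto_atTop)).exists_seq_tendsto_ae
  filter_upwards [h1, h2, ae_all_iff.2 h] with ξ h3 h4 h5
  refine tendsto_nhds_unique (h3.comp hms.tendsto_atTop) ((h4.const_mul (m ξ)).congr fun n => ?_)
  exact (h5 (ns (ms n))).symm

theorem fourier_reflectTranslate_schwartz (t : ℝ) (φ : SchwartzMap ℝ ℂ) :
    (𝓕 (reflectTranslate t (φ.toLp 2)) : Lp ℂ 2 (volume : Measure ℝ)) =ᵐ[volume]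
      fun ξ => Complex.exp (↑(-2 * Real.pi * (t * ξ)) * Complex.I) *
        reflectTranslate 0 (𝓕 (φ.toLp 2)) ξ := by
  let ψ : SchwartzMap ℝ ℂ := SchwartzMap.compSubConstCLM ℂ t
    (SchwartzMap.compCLMOfContinuousLinearEquiv ℂ (ContinuousLinearEquiv.neg ℝ) φ)
  have hψ : ∀ x, ψ x = φ (t - x) := fun x => by simp [ψ]
  have h1 : reflectTranslate t (φ.toLp 2) = ψ.toLp 2 := by
    apply Lp.ext
    have h2 := (Measure.measurePreserving_sub_left volume t).quasiMeasurePreserving.ae_eq_comp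
      (φ.coeFn_toLp 2 volume)
    filter_upwards [coeFn_reflectTranslate t (φ.toLp 2), h2, ψ.coeFn_toLp 2 volume]
      with x h3 h4 h5
    rw [h3, h5, hψ]
    exact h4
  rw [h1, SchwartzMap.toLp_fourier_eq, SchwartzMap.toLp_fourier_eq]
  have h2 := (Measure.measurePreserving_sub_left volume (0 : ℝ)).quasiMeasurePreserving.ae_eq_comp
    ((𝓕 φ).coeFn_toLp 2 volume)
  filter_upwards [(𝓕 ψ).coeFn_toLp 2 volume, coeFn_reflectTranslate 0 ((𝓕 φ).toLp 2), h2]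
    with ξ h3 h4 h5
  rw [h3, h4]
  refine Eq.trans ?_ (congrArg _ h5.symm)
  simp only [Function.comp_apply, SchwartzMap.fourier_coe, Real.fourier_real_eq_integral_exp_smul]
  rw [← integral_const_mul, ← integral_sub_left_eq_self _ volume t]
  refine integral_congr_ae (Eventually.of_forall fun x => ?_)
  simp only [hψ, sub_sub_cancel, smul_eq_mul]
  rw [← mul_assoc, ← Complex.exp_add]
  congr 2
  push_cast
  ring

/-- The Fourier transform turns `s ↦ g (t - s)` into `ξ ↦ exp (-2πitξ) ĝ (-ξ)`. -/
theorem fourier_reflectTranslate (t : ℝ) (g : Lp ℂ 2 (volume : Measure ℝ)) :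
    (𝓕 (reflectTranslate t g) : Lp ℂ 2 (volume : Measure ℝ)) =ᵐ[volume]
      fun ξ => Complex.exp (↑(-2 * Real.pi * (t * ξ)) * Complex.I) *
        reflectTranslate 0 (𝓕 g) ξ := by
  have hd : DenseRange (SchwartzMap.toLpCLM ℝ ℂ 2 (volume : Measure ℝ)) :=
    SchwartzMap.denseRange_toLpCLM (by simp)
  obtain ⟨u, hu, hlim⟩ := mem_closure_iff_seq_limit.1 (hd g)
  choose φ hφ using hu
  have hF : Continuous (𝓕 : Lp ℂ 2 (volume : Measure ℝ) → Lp ℂ 2 (volume : Measure ℝ)) :=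
    (Lp.fourierTransformₗᵢ ℝ ℂ).continuous
  refine ae_eq_mul_of_tendsto
    (((hF.comp (reflectTranslate t).continuous).tendsto g).comp hlim)
    ((((reflectTranslate 0).continuous.comp hF).tendsto g).comp hlim) fun n => ?_
  simp only [Function.comp_apply, ← hφ n]
  exact fourier_reflectTranslate_schwartz t (φ n)

/-- An integrable function with vanishing Fourier transform vanishes. -/
theorem ae_eq_zero_of_integral_exp_mul_eq_zero {G : ℝ → ℂ} (hG : Integrable G)
    (h : ∀ t : ℝ, ∫ ξ, Complex.exp (↑(2 * Real.pi * (t * ξ)) * Complex.I) * G ξ = 0) :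
    G =ᵐ[volume] 0 := by
  refine ae_eq_zero_of_integral_contDiff_smul_eq_zero hG.locallyIntegrable fun g hg hgc => ?_
  let ψ : SchwartzMap ℝ ℂ := (hgc.comp_left (g := fun x : ℝ => (x : ℂ)) (by simp)).toSchwartzMap
    (Complex.ofRealCLM.contDiff.comp hg)
  have hψ : ∀ x, ψ x = g x := fun x => rfl
  let φ : SchwartzMap ℝ ℂ := 𝓕⁻ ψ
  have hφ : (𝓕 (φ : ℝ → ℂ)) = ψ := by
    rw [← SchwartzMap.fourier_coe, FourierTransform.fourier_fourierInv_eq]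
  have hflip := VectorFourier.integral_fourierIntegral_smul_eq_flip (L := innerₗ ℝ)
    (μ := volume) (ν := volume) Real.continuous_fourierChar continuous_inner φ.integrable hG
  have hG0 : ∀ x, VectorFourier.fourierIntegral Real.fourierChar volume (innerₗ ℝ).flip G x = 0 := by
    intro x
    rw [flip_innerₗ]
    change 𝓕 G x = 0
    rw [Real.fourier_real_eq_integral_exp_smul, ← h (-x)]
    refine integral_congr_ae (Eventually.of_forall fun v => ?_)
    simp only [smul_eq_mul]
    congr 3
    push_cast; ring
  simp only [hG0, smul_zero, integral_zero] at hflip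
  refine Eq.trans (integral_congr_ae (Eventually.of_forall fun x => ?_)) hflip
  change g x • G x = 𝓕 (φ : ℝ → ℂ) x • G x
  rw [hφ, hψ, Complex.real_smul, smul_eq_mul]

theorem inner_reflectTranslate (t : ℝ) (F h : Lp ℂ 2 (volume : Measure ℝ)) :
    inner ℂ (reflectTranslate t F) h =
      ∫ ξ, Complex.exp (↑(2 * Real.pi * (t * ξ)) * Complex.I) *
        inner ℂ (reflectTranslate 0 (𝓕 F) ξ) ((𝓕 h : Lp ℂ 2 (volume : Measure ℝ)) ξ) := by
  rw [← Lp.inner_fourier_eq, L2.inner_def]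
  refine integral_congr_ae ?_
  filter_upwards [fourier_reflectTranslate t F] with ξ hξ
  rw [hξ, ← smul_eq_mul, inner_smul_left, ← Complex.exp_conj]
  congr 2
  simp only [map_mul, Complex.conj_ofReal, Complex.conj_I]
  push_cast; ring

theorem forall_inner_reflectTranslate_eq_zero_iff (F h : Lp ℂ 2 (volume : Measure ℝ)) :
    (∀ t, inner ℂ (reflectTranslate t F) h = 0) ↔
      ∀ᵐ ξ, inner ℂ (reflectTranslate 0 (𝓕 F) ξ) ((𝓕 h : Lp ℂ 2 (volume : Measure ℝ)) ξ) = 0 := by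
  simp_rw [inner_reflectTranslate]
  refine ⟨fun H => ae_eq_zero_of_integral_exp_mul_eq_zero (L2.integrable_inner _ _) H,
    fun H t => ?_⟩
  refine integral_eq_zero_of_ae ?_
  filter_upwards [H] with ξ hξ
  rw [hξ, mul_zero, Pi.zero_apply]

theorem ae_reflectTranslate_zero_ne_zero_iff (g : Lp ℂ 2 (volume : Measure ℝ)) :
    (∀ᵐ ξ, reflectTranslate 0 g ξ ≠ 0) ↔ ∀ᵐ ξ, g ξ ≠ 0 := by
  have hmp := (Measure.measurePreserving_sub_left volume (0 : ℝ)).quasiMeasurePreserving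
  constructor
  · intro h
    filter_upwards [hmp.ae h, hmp.ae (coeFn_reflectTranslate 0 g)] with ξ h1 h2
    rw [h2] at h1
    simpa using h1
  · intro h
    filter_upwards [hmp.ae h, coeFn_reflectTranslate 0 g] with ξ h1 h2
    rw [h2]
    exact h1

/-- Wiener's theorem: no nonzero function is orthogonal to all translates of `F` if and only if
the Fourier transform of `F` vanishes almost nowhere. -/
theorem forall_orthogonal_translates_iff (F : Lp ℂ 2 (volume : Measure ℝ)) :
    (∀ h, (∀ t, inner ℂ (reflectTranslate t F) h = 0) → h = 0) ↔
      ∀ᵐ ξ, (𝓕 F : Lp ℂ 2 (volume : Measure ℝ)) ξ ≠ 0 := by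
  rw [← ae_reflectTranslate_zero_ne_zero_iff]
  simp_rw [forall_inner_reflectTranslate_eq_zero_iff]
  constructor
  · intro H
    set B : Set ℝ := {ξ | reflectTranslate 0 (𝓕 F) ξ = 0} with hB
    have hBm : MeasurableSet B :=
      (Lp.stronglyMeasurable (reflectTranslate 0 (𝓕 F))).measurable (measurableSet_singleton 0)
    -- the inverse transform of the indicator of a bounded part of `B` is orthogonal to all translates
    have hn : ∀ n : ℕ, volume (B ∩ Set.Ioc (-n : ℝ) n) = 0 := by
      intro n
      have hm : MeasurableSet (B ∩ Set.Ioc (-n : ℝ) n) := hBm.inter measurableSet_Ioc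
      have hfin : volume (B ∩ Set.Ioc (-n : ℝ) n) ≠ ∞ :=
        measure_ne_top_of_subset Set.inter_subset_right measure_Ioc_lt_top.ne
      let h : Lp ℂ 2 (volume : Measure ℝ) := 𝓕⁻ (indicatorConstLp 2 hm hfin (1 : ℂ))
      have hFh : 𝓕 h = indicatorConstLp 2 hm hfin (1 : ℂ) :=
        FourierTransform.fourier_fourierInv_eq _
      have h0 : h = 0 := by
        refine H h ?_
        rw [hFh]
        filter_upwards [indicatorConstLp_coeFn (p := 2) (hs := hm) (hμs := hfin) (c := (1 : ℂ))]
          with ξ hξ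
        rw [hξ]
        by_cases hξB : ξ ∈ B
        · rw [show reflectTranslate 0 (𝓕 F) ξ = 0 from hξB, inner_zero_left]
        · rw [Set.indicator_of_notMem fun h => hξB h.1, inner_zero_right]
      have h1 : ‖indicatorConstLp 2 hm hfin (1 : ℂ)‖ = 0 := by
        rw [← hFh, Lp.norm_fourier_eq, h0, norm_zero]
      rw [norm_indicatorConstLp (by norm_num) (by norm_num), norm_one, one_mul,
        Real.rpow_eq_zero measureReal_nonneg (by norm_num), measureReal_eq_zero_iff hfin] at h1
      exact h1
    have hsub : B ⊆ ⋃ n : ℕ, B ∩ Set.Ioc (-n : ℝ) n := fun x hx => by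
      obtain ⟨n, hn⟩ := exists_nat_gt |x|
      have := abs_lt.1 hn
      exact Set.mem_iUnion.2 ⟨n, hx, this.1, this.2.le⟩
    rw [ae_iff]
    simp only [ne_eq, not_not]
    exact measure_mono_null hsub (measure_iUnion_null hn)
  · intro H h hh
    have h1 : (𝓕 h : Lp ℂ 2 (volume : Measure ℝ)) = 0 := by
      rw [Lp.eq_zero_iff_ae_eq_zero]
      filter_upwards [H, hh] with ξ h2 h3
      rw [RCLike.inner_apply, mul_eq_zero] at h3
      exact h3.resolve_right fun h4 => h2 (by simpa using h4)
    rw [← norm_eq_zero, ← Lp.norm_fourier_eq, h1, norm_zero]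

variable {f : ℝ → ℝ}

theorem memLp_reflectTranslate (hf : MemLp f 2 volume) (t : ℝ) :
    MemLp (fun s => f (t - s)) 2 volume :=
  hf.comp_measurePreserving (Measure.measurePreserving_sub_left volume t)

theorem inner_reflectTranslate_ofReal (hf : MemLp f 2 volume) (t : ℝ)
    (h : Lp ℂ 2 (volume : Measure ℝ)) :
    inner ℂ (reflectTranslate t (MemLp.toLp (fun s => (f s : ℂ)) hf.ofReal)) h =
      ∫ s, f (t - s) • h s := by
  rw [L2.inner_def]
  have h2 := (Measure.measurePreserving_sub_left volume t).quasiMeasurePreserving.ae_eq_comp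
    (MemLp.coeFn_toLp (f := fun s => (f s : ℂ)) hf.ofReal)
  refine integral_congr_ae ?_
  filter_upwards [coeFn_reflectTranslate t (MemLp.toLp (fun s => (f s : ℂ)) hf.ofReal), h2]
    with s h3 h4
  have h5 : MemLp.toLp (fun s => (f s : ℂ)) hf.ofReal (t - s) = (f (t - s) : ℂ) := h4
  rw [h3, h5, RCLike.inner_apply, Complex.conj_ofReal,
    Complex.real_smul, mul_comm]

theorem inner_toLp_reflectTranslate (hf : MemLp f 2 volume) (t : ℝ)
    (h : Lp ℝ 2 (volume : Measure ℝ)) :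
    inner ℝ ((memLp_reflectTranslate hf t).toLp _) h = ∫ s, f (t - s) * h s := by
  rw [L2.inner_def]
  refine integral_congr_ae ?_
  filter_upwards [(memLp_reflectTranslate hf t).coeFn_toLp] with s hs
  rw [hs, real_inner_eq_re_inner, RCLike.inner_apply]
  simp [mul_comm]

/-- Wiener's theorem for real functions: the translates of `f` span a dense subspace of `L²(ℝ)` if
and only if the Fourier transform of `f` vanishes almost nowhere. -/
theorem topologicalClosure_span_translates_eq_top_iff (hf : MemLp f 2 volume) :
    (Submodule.span ℝ (Set.range fun t =>
      (memLp_reflectTranslate hf t).toLp _)).topologicalClosure = ⊤ ↔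
      ∀ᵐ ξ, plancherelFourier f hf ξ ≠ 0 := by
  rw [plancherelFourier, ← forall_orthogonal_translates_iff,
    Submodule.topologicalClosure_eq_top_iff, Submodule.eq_bot_iff]
  have hmem : ∀ h : Lp ℝ 2 (volume : Measure ℝ),
      h ∈ (Submodule.span ℝ (Set.range fun t => (memLp_reflectTranslate hf t).toLp _))ᗮ ↔
        ∀ t, ∫ s, f (t - s) * h s = 0 := by
    intro h
    simp_rw [← inner_toLp_reflectTranslate hf]
    rw [Submodule.mem_orthogonal]
    constructor
    · exact fun H t => H _ (Submodule.subset_span ⟨t, rfl⟩)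
    · intro H u hu
      induction hu using Submodule.span_induction with
      | mem u hu => obtain ⟨t, rfl⟩ := hu; exact H t
      | zero => exact inner_zero_left _
      | add u v _ _ hu hv => rw [inner_add_left, hu, hv, add_zero]
      | smul a u _ hu => rw [inner_smul_left, hu, mul_zero]
  simp_rw [hmem, inner_reflectTranslate_ofReal hf]
  constructor
  · intro H h hh
    have hint : ∀ t, Integrable fun s => f (t - s) • h s := fun t =>
      memLp_one_iff_integrable.1 ((Lp.memLp h).smul (memLp_reflectTranslate hf t))
    -- the real and the imaginary part of `h` are orthogonal to the translates of `f`
    have hre := H ((Lp.memLp h).re.toLp _) fun t => by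
      rw [← Complex.zero_re, ← hh t]
      refine Eq.trans (integral_congr_ae ?_) (integral_re (hint t))
      filter_upwards [(Lp.memLp h).re.coeFn_toLp] with s hs
      rw [hs]
      simp
    have him := H ((Lp.memLp h).im.toLp _) fun t => by
      rw [← Complex.zero_im, ← hh t]
      refine Eq.trans (integral_congr_ae ?_) (integral_im (hint t))
      filter_upwards [(Lp.memLp h).im.coeFn_toLp] with s hs
      rw [hs]
      simp
    rw [Lp.eq_zero_iff_ae_eq_zero] at hre him ⊢
    filter_upwards [hre, him, (Lp.memLp h).re.coeFn_toLp, (Lp.memLp h).im.coeFn_toLp]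
      with s h1 h2 h3 h4
    rw [h3] at h1
    rw [h4] at h2
    exact Complex.ext h1 h2
  · intro H h hh
    have h1 := H (MemLp.toLp (fun s => (h s : ℂ)) (Lp.memLp h).ofReal) fun t => by
      rw [← Complex.ofReal_zero, ← hh t]
      refine Eq.trans (integral_congr_ae ?_) integral_complex_ofReal
      filter_upwards [MemLp.coeFn_toLp (f := fun s => (h s : ℂ)) (Lp.memLp h).ofReal] with s hs
      rw [hs]
      simp
    rw [Lp.eq_zero_iff_ae_eq_zero] at h1 ⊢
    filter_upwards [h1, MemLp.coeFn_toLp (f := fun s => (h s : ℂ)) (Lp.memLp h).ofReal]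
      with s h2 h3
    rw [h3] at h2
    exact Complex.ofReal_eq_zero.1 h2

end Translates

/-! ### Closed spans -/

section Spans

variable {Ω E : Type*} [MeasurableSpace Ω] {P : Measure Ω} [NormedAddCommGroup E]
  [InnerProductSpace ℝ E] {L : ℝ → Ω → E} {σ : ℝ}
  {W : Lp ℝ 2 (volume : Measure ℝ) →L[ℝ] Lp E 2 P}

theorem IsItoIntegral.isClosedEmbedding (hW : IsItoIntegral P L σ W) :
    IsClosedEmbedding W := by
  have h : AntilipschitzWith (⟨σ⁻¹, (inv_pos.2 hW.pos).le⟩ : NNReal) W := by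
    refine W.antilipschitz_of_bound fun x => ?_
    rw [hW.norm_map]
    show ‖x‖ ≤ σ⁻¹ * (σ * ‖x‖)
    rw [inv_mul_cancel_left₀ hW.pos.ne']
  exact h.isClosedEmbedding W.uniformContinuous

theorem IsItoIntegral.closedSpanL2_eq_map (hW : IsItoIntegral P L σ W) {X : ℝ → Ω → E}
    {x : ℝ → Lp ℝ 2 (volume : Measure ℝ)} (hX : ∀ t, W (x t) =ᵐ[P] X t) :
    closedSpanL2 P X =
      (Submodule.span ℝ (Set.range x)).topologicalClosure.map (W : _ →ₗ[ℝ] Lp E 2 P) := by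
  have hset : {Y : Lp E 2 P | ∃ t : ℝ, Y =ᵐ[P] X t} = W '' Set.range x := by
    ext Y
    constructor
    · rintro ⟨t, ht⟩
      exact ⟨x t, ⟨t, rfl⟩, Lp.ext ((hX t).trans ht.symm)⟩
    · rintro ⟨_, ⟨t, rfl⟩, rfl⟩
      exact ⟨t, hX t⟩
  rw [closedSpanL2, hset]
  apply SetLike.coe_injective
  rw [Submodule.topologicalClosure_coe, Submodule.map_coe, Submodule.topologicalClosure_coe,
    show (⇑(W : _ →ₗ[ℝ] Lp E 2 P)) = W from rfl, ← hW.isClosedEmbedding.closure_image_eq]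
  congr 1
  have := Submodule.map_span (W : _ →ₗ[ℝ] Lp E 2 P) (Set.range x)
  exact (congrArg (fun S : Submodule ℝ (Lp E 2 P) => (S : Set (Lp E 2 P))) this).symm

/-- The closed span of the moving average is the image under the Itô isometry of the closed span of
the translates of the kernel; the closed span of `L` is the whole range of the isometry. -/
theorem IsItoIntegral.closedSpanL2_eq_iff (hW : IsItoIntegral P L σ W) {X : ℝ → Ω → E}
    {x : ℝ → Lp ℝ 2 (volume : Measure ℝ)} (hX : ∀ t, W (x t) =ᵐ[P] X t) :
    closedSpanL2 P X = closedSpanL2 P L ↔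
      (Submodule.span ℝ (Set.range x)).topologicalClosure = ⊤ := by
  rw [hW.closedSpanL2_eq_map hX, hW.closedSpanL2_eq_map hW.map_signedIndicator,
    topologicalClosure_span_signedIndicator]
  exact (Submodule.map_injective_of_injective hW.isClosedEmbedding.injective).eq_iff

end Spans

end LevyMovingAverage

open LevyMovingAverage in
theorem mainTheorem5 {Ω : Type*} [MeasurableSpace Ω] (P : Measure Ω) [IsProbabilityMeasure P]
    {d : ℕ} (L : ℝ → Ω → EuclideanSpace ℝ (Fin d)) (hL : IsLevyProcess P L)
    (hL_sq : ∀ t, MemLp (L t) 2 P) (hL_centered : ∀ t, ∫ ω, L t ω ∂P = 0)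
    (hL_nonzero : ∃ t, ¬ L t =ᵐ[P] 0)
    (f : ℝ → ℝ) (hf : Measurable f) :
    ((∃ X : ℝ → Ω → EuclideanSpace ℝ (Fin d),
        IsMovingAverage P L f X ∧ ∀ t, MemLp (X t) 2 P) ↔ MemLp f 2 volume) ∧
    ∀ (hf_sq : MemLp f 2 volume) (X : ℝ → Ω → EuclideanSpace ℝ (Fin d)),
      IsMovingAverage P L f X →
        (∀ t, MemLp (X t) 2 P) ∧
        ((∀ᵐ ξ : ℝ, plancherelFourier f hf_sq ξ ≠ 0) ↔
          closedSpanL2 P X = closedSpanL2 P L) := by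
  obtain ⟨σ, W, hW⟩ := exists_isItoIntegral hL hL_sq hL_centered hL_nonzero
  have hft : ∀ t, Measurable fun s => f (t - s) := fun t => by fun_prop
  refine ⟨⟨?_, fun hf_sq => ?_⟩, fun hf_sq X hX => ?_⟩
  · rintro ⟨X, hX, hX_sq⟩
    have h := hW.memLp_of_hasStochIntegral hL hL_centered (hft 0) (hX 0) (hX_sq 0)
    simpa using memLp_reflectTranslate h 0
  · exact ⟨fun t => itoIntegral W fun s => f (t - s), fun t => hW.hasStochIntegral hL hL_centered
      (hft t) (memLp_reflectTranslate hf_sq t), fun t => Lp.memLp _⟩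
  · have hXt : ∀ t, X t =ᵐ[P] itoIntegral W fun s => f (t - s) := fun t =>
      hW.ae_eq_of_hasStochIntegral hL hL_centered (hft t) (memLp_reflectTranslate hf_sq t) (hX t)
    refine ⟨fun t => (Lp.memLp _).ae_eq (hXt t).symm, ?_⟩
    rw [← topologicalClosure_span_translates_eq_top_iff hf_sq]
    refine (hW.closedSpanL2_eq_iff fun t => ?_).symm
    rw [← itoIntegral_of_memLp]
    exact (hXt t).symm
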